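/- **Setting.** Let $\mathfrak g$ be a finite-dimensional semisimple complex Lie algebra with basis $(I^a)$, let $\kappa$ be the opposite of its Killing form, and let $C_{12}\in\mathfrak g\otimes\mathfrak g$ be the corresponding split Casimir. Let $\Sigma$ be a finite set of sites with multiplicities $m_\alpha\ge 1$, pairwise distinct positions $z_\alpha\in\mathbb C$ and levels $\ell^\alpha_p\in\mathbb C$ ($0\le p<m_\alpha$), with $\ell^\alpha_{m_\alpha-1}\neq 0$. Put $$\varphi(z)=\sum_{\alpha}\sum_{p<m_\alpha}\frac{\ell^\alpha_p}{(z-z_\alpha)^{p+1}} .$$ Assume the first-class condition $\sum_\alpha \ell^\alpha_0=0$, and that all zeros of the 1-form $\varphi(z)\,dz$ on the Riemann sphere (infinity included, if it is a zero) are simple; call these zeros $\zeta_1,\dots,\zeta_M$ (pairwise distinct). Let $\mathcal A$ be a Poisson algebra of local fields in one space dimension (a Poisson vertex algebra over $\mathbb C$) with spatial derivative $\partial_x$, and let $J^\alpha_p(x)$ be $\mathfrak g$-valued fields of $\mathcal A$ with $$\{J^\alpha_{p}(x)_{1},J^\beta_{q}(y)_{2}\}=\delta_{\alpha\beta}\bigl([C_{12},J^\alpha_{p+q}(x)_{1}]\,\delta_{xy}-\ell^\alpha_{p+q}\,C_{12}\,\delta'_{xy}\bigr)\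 \text{ if } p+q<m_\alpha,$$ and $0$ if $\alpha\ne\beta$ or $p+q\ge m_\alpha$. Put $\Gamma(z,x)=\sum_{\alpha,p}J^\alpha_p(x)(z-z_\alpha)^{-p-1}$ and $\mathcal C(x)=\sum_\alpha J^\alpha_0(x)$. *Weak equality* $f\approx g$ means that $f-g$ lies in the ideal of $\mathcal A$ generated by the components of $\mathcal C$ and of all its spatial derivatives. Put $$q_i(x)=-\operatorname*{res}_{z=\zeta_i}\frac{\kappa(\Gamma(z,x),\Gamma(z,x))}{2\varphi(z)}\,dz,\qquad \mathfrak p(x)=\sum_\alpha \frac12\sum_{q,r=0}^{m_\alpha-1}k^\alpha_{q+r}\,\kappa\bigl(J^\alpha_q(x),J^\alpha_r(x)\bigr),$$ where the numbers $k^\alpha_n$ are the solution of $\sum_{p=0}^{m_\alpha-1-r}k^\alpha_{p+q}\ell^\alpha_{p+r}=\delta_{q,r}$ ($0\le q,r<m_\alpha$). Assume that the realisation is suitable: $\mathcal P_{\mathcal A}=\int\mathfrak p$ is the momentum of $\mathcal A$, that is $\{\mathcal P_{\mathcal A},f\}=\partial_xf$ for all $f\in\mathcal A$. For $\epsilon_1,\dots,\epsilon_M\in\mathbb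 C$ consider the model with first-class Hamiltonian $\mathcal H_0=\sum_i\epsilon_i\int q_i$ and time evolution $$\partial_t f\approx\{\mathcal H_0,f\}+\int dy\,\kappa\bigl(\mu(y),\{\mathcal C(y),f\}\bigr),$$ where the Lagrange multiplier $\mu=\mu_aI^a$ is an independent auxiliary field. An *energy-momentum tensor* of the model consists of fields $T^\mu{}_\nu\in\mathcal A$ ($\mu,\nu\in\{0,1\}$, $0$ for time and $1$ for space) such that $T^0{}_0\approx\sum_i\epsilon_iq_i$ (the density of $\mathcal H_0$), $T^0{}_1\approx\mathfrak p$ (the density of $\mathcal P_{\mathcal A}$), and $\partial_tT^0{}_\nu+\partial_xT^1{}_\nu\approx0$ for $\nu=0,1$. **Proposition.** (a) The components of the energy-momentum tensor are $$T^0{}_1\approx\sum_{i=1}^M q_i,\qquad T^0{}_0\approx-T^1{}_1\approx\sum_{i=1}^M\epsilon_i\,q_i,\qquad T^1{}_0\approx-\sum_{i=1}^M\epsilon_i^2\,q_i .$$ More precisely, these expressions define an energy-momentum tensor, and the components of every energy-momentum tensor are weakly equal to them, up to adding to $T^1{}_1$ and to $T^1{}_0$ fields $c$ that are spatially constant ($\partial_xc\approx0$),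 which the conservation law cannot detect. (b) Let $\eta=\operatorname{diag}(1,-1)$, and call the model relativistic if it has an energy-momentum tensor for which $T_{\mu\nu}=\sum_\rho\eta_{\mu\rho}T^\rho{}_\nu$ is weakly symmetric, i.e. $T_{01}\approx T_{10}$. If $\mathfrak g\ne0$ and the constraint surface is non-empty (i.e. $1\not\approx0$), then the model is relativistic if and only if $\epsilon_i=\pm1$ for every $i\in\{1,\dots,M\}$. -/

import Mathlib

open scoped TensorProduct

noncomputable section

namespace AffineGaudin

/-! ### Poisson algebras of local fields on the line or the circle -/

section PoissonVertexAlgebra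

variable {A : Type*} [CommRing A] [Algebra ℂ A]

open Polynomial in
/-- The operator `lam + D` on polynomials in the variable `lam` (written `X`) with coefficients in
`A`, where the derivation `D` acts on the coefficients. -/
def lamAddD (D : Derivation ℂ A A) (P : A[X]) : A[X] :=
  X * P + P.sum fun n c => monomial n (D c)

open Polynomial in
/-- A Poisson bracket on a commutative algebra `A` of local fields (a Poisson vertex algebra).
`D` is the spatial derivative; `bracket a b` is the polynomial
`∫ dx exp (lam (x - y)) {a(x), b(y)}` in the variable `lam`, evaluated at the point `y`. In other
words `bracket a b = ∑ lam ^ n c_n` encodes the local Poisson bracket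
`{a(x), b(y)} = ∑ c_n(y) (- ∂_x) ^ n δ(x - y)`. In particular `(bracket a b).coeff 0` is the field
`{∫ a, b(y)}`. The axioms are the translations of the compatibility with `∂_x`, `∂_y`, of the
skew-symmetry, of the Leibniz rule and of the Jacobi identity. -/
structure PoissonVertexAlgebra (A : Type*) [CommRing A] [Algebra ℂ A] where
  /-- the spatial derivative -/
  D : Derivation ℂ A A
  /-- the Poisson bracket of local fields -/
  bracket : A →ₗ[ℂ] A →ₗ[ℂ] A[X]
  bracket_D_left : ∀ a b, bracket (D a) b = -(X * bracket a b)
  bracket_D_right : ∀ a b, bracket a (D b) = lamAddD D (bracket a b)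
  skew : ∀ a b, bracket b a =
    -((bracket a b).sum fun n c => (-1 : A[X]) ^ n * (lamAddD D)^[n] (C c))
  leibniz : ∀ a b c, bracket a (b * c) = C b * bracket a c + C c * bracket a b
  /-- The coefficient of `lam ^ m * mu ^ n` in
  `{a_lam {b_mu c}} - {b_mu {a_lam c}} = {{a_lam b}_(lam + mu) c}`. -/
  jacobi : ∀ a b c m n,
    (bracket a ((bracket b c).coeff n)).coeff m - (bracket b ((bracket a c).coeff m)).coeff n =
      ∑ k ∈ Finset.range (m + 1), (Nat.choose (m - k + n) n : A) *
        (bracket ((bracket a b).coeff k) c).coeff (m - k + n)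

end PoissonVertexAlgebra

/-! ### Residues of rational 1-forms on the Riemann sphere -/

section Residues

/-- The coordinate `z`, as a function of the local parameter `u` at a point of the Riemann sphere:
`z = ζ + u` at a finite point `ζ`, and `z = 1 / u` at infinity. -/
def coordAt (c : OnePoint ℂ) : LaurentSeries ℂ :=
  c.elim (HahnSeries.single (-1) 1) (fun ζ => HahnSeries.C ζ + HahnSeries.single 1 1)

/-- The derivative `dz / du` for the local parameter `u` at a point of the Riemann sphere. -/
def jacobianAt (c : OnePoint ℂ) : LaurentSeries ℂ :=
  c.elim (-HahnSeries.single (-2) 1) (fun _ => 1)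

theorem coordAt_ne_C (c : OnePoint ℂ) (r : ℂ) : coordAt c ≠ HahnSeries.C r := by
  intro h
  cases c with
  | infty =>
    have := congrArg (fun s : LaurentSeries ℂ => s.coeff (-1)) h
    simp [coordAt, HahnSeries.C_apply] at this
  | coe ζ =>
    have := congrArg (fun s : LaurentSeries ℂ => s.coeff 1) h
    simp [coordAt, HahnSeries.C_apply] at this

theorem eval₂_coordAt_ne_zero (c : OnePoint ℂ) {p : Polynomial ℂ} (hp : p ≠ 0) :
    p.eval₂ HahnSeries.C (coordAt c) ≠ 0 := by
  intro h
  have hs := (IsAlgClosed.splits p).eq_prod_roots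
  rw [hs, ← Polynomial.coe_eval₂RingHom] at h
  simp only [map_mul, Polynomial.coe_eval₂RingHom, Polynomial.eval₂_C, map_multiset_prod,
    Multiset.map_map, mul_eq_zero, Multiset.prod_eq_zero_iff, Multiset.mem_map,
    Function.comp_apply, Polynomial.eval₂_sub, Polynomial.eval₂_X] at h
  rcases h with h | ⟨r, -, hr⟩
  · exact hp (by simpa using h)
  · exact coordAt_ne_C c r (sub_eq_zero.mp hr)

theorem nonZeroDivisors_le_comap_coordAt (c : OnePoint ℂ) :
    nonZeroDivisors (Polynomial ℂ) ≤ (nonZeroDivisors (LaurentSeries ℂ)).comap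
      (Polynomial.eval₂RingHom HahnSeries.C (coordAt c)) := fun _ hp =>
  mem_nonZeroDivisors_of_ne_zero (eval₂_coordAt_ne_zero c (nonZeroDivisors.ne_zero hp))

/-- The Laurent expansion of a rational function of `z` in the local parameter at a point of the
Riemann sphere. -/
def expansionAt (c : OnePoint ℂ) : RatFunc ℂ →+* LaurentSeries ℂ :=
  RatFunc.liftRingHom (Polynomial.eval₂RingHom HahnSeries.C (coordAt c))
    (nonZeroDivisors_le_comap_coordAt c)

theorem expansionAt_C (c : OnePoint ℂ) (r : ℂ) :
    expansionAt c (RatFunc.C r) = HahnSeries.C r := by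
  rw [← RatFunc.algebraMap_C, expansionAt, RatFunc.liftRingHom_algebraMap]
  simp

/-- The 1-form `f(z) dz` in the local parameter `u`: the Laurent series `g(u)` with
`f(z) dz = g(u) du`. -/
def formAt (c : OnePoint ℂ) (f : RatFunc ℂ) : LaurentSeries ℂ := jacobianAt c * expansionAt c f

/-- The residue of `f(z) dz` at a point of the Riemann sphere. -/
def residueAt (c : OnePoint ℂ) : RatFunc ℂ →ₗ[ℂ] ℂ where
  toFun f := (formAt c f).coeff (-1)
  map_add' f g := by simp [formAt, mul_add]
  map_smul' r f := by
    rw [RatFunc.smul_eq_C_mul, formAt, map_mul, expansionAt_C, mul_left_comm,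
      HahnSeries.C_mul_eq_smul, HahnSeries.coeff_smul, RingHom.id_apply, formAt]

/-- The residue of an `A`-valued rational 1-form. -/
def residueAtA (A : Type*) [CommRing A] [Algebra ℂ A] (c : OnePoint ℂ) :
    RatFunc ℂ ⊗[ℂ] A →ₗ[ℂ] A :=
  (TensorProduct.lid ℂ A).toLinearMap.comp (LinearMap.rTensor A (residueAt c))

end Residues

/-! ### Takiff data, twist function -/

/-- The parameters of an affine Gaudin model with finite set of sites `S`: multiplicities `m α`,
levels `ℓ α p` for `p < m α` (other values are never used) with non-zero highest level, and
pairwise distinct positions `z α`. -/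
structure GaudinParameters (S : Type*) where
  m : S → ℕ
  m_pos : ∀ α, 0 < m α
  ℓ : S → ℕ → ℂ
  ℓ_top : ∀ α, ℓ α (m α - 1) ≠ 0
  z : S → ℂ
  z_injective : Function.Injective z

namespace GaudinParameters

variable {S : Type*} (P : GaudinParameters S)

/-- The rational function `1 / (z - z_α) ^ (p + 1)`. -/
def pole (α : S) (p : ℕ) : RatFunc ℂ := ((RatFunc.X - RatFunc.C (P.z α)) ^ (p + 1))⁻¹

/-- The twist function. -/
def twist [Fintype S] : RatFunc ℂ :=
  ∑ α, ∑ p ∈ Finset.range (P.m α), RatFunc.C (P.ℓ α p) * P.pole α p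

/-- The power series `ℓ_{m-1} + ℓ_{m-2} u + ... + ℓ_0 u ^ (m-1)` at the site `α`. -/
def levelSeries (α : S) : PowerSeries ℂ :=
  PowerSeries.mk fun j => if j < P.m α then P.ℓ α (P.m α - 1 - j) else 0

/-- The numbers `k_n` entering the Segal-Sugawara integrals; they are the solution of the linear
system proved in `sum_k_mul_ℓ`. -/
def k (α : S) (n : ℕ) : ℂ :=
  if P.m α ≤ n + 1 then PowerSeries.coeff (n + 1 - P.m α) (P.levelSeries α)⁻¹ else 0

theorem sum_k_mul_ℓ (α : S) (q r : ℕ) (hq : q < P.m α) (hr : r < P.m α) :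
    ∑ p ∈ Finset.range (P.m α - r), P.k α (p + q) * P.ℓ α (p + r) = if q = r then 1 else 0 := by
  have h0 : PowerSeries.constantCoeff (P.levelSeries α) ≠ 0 := by
    rw [← PowerSeries.coeff_zero_eq_constantCoeff_apply, levelSeries, PowerSeries.coeff_mk,
      if_pos (P.m_pos α)]
    exact P.ℓ_top α
  have hmul := PowerSeries.mul_inv_cancel (P.levelSeries α) h0
  have key : ∀ j ∈ Finset.range (P.m α - r),
      P.k α (P.m α - r - 1 - j + q) * P.ℓ α (P.m α - r - 1 - j + r) =
        if j + r ≤ q then PowerSeries.coeff j (P.levelSeries α) *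
          PowerSeries.coeff (q - r - j) (P.levelSeries α)⁻¹ else 0 := by
    intro j hj
    rw [Finset.mem_range] at hj
    by_cases h : j + r ≤ q
    · rw [if_pos h, k, if_pos (by omega), levelSeries, PowerSeries.coeff_mk, if_pos (by omega),
        mul_comm]
      congr 2 <;> first | omega | (congr 1; omega)
    · rw [if_neg h, k, if_neg (by omega), zero_mul]
  rw [← Finset.sum_range_reflect, Finset.sum_congr rfl key]
  by_cases hqr : r ≤ q
  · have hc := congrArg (PowerSeries.coeff (q - r)) hmul
    rw [PowerSeries.coeff_mul, PowerSeries.coeff_one,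
      Finset.Nat.sum_antidiagonal_eq_sum_range_succ_mk] at hc
    have hiff : (q - r = 0) ↔ (q = r) := by omega
    simp only [hiff] at hc
    rw [← hc, ← Finset.sum_filter]
    refine Finset.sum_congr ?_ (fun _ _ => rfl)
    ext j
    simp only [Finset.mem_filter, Finset.mem_range]
    omega
  · rw [if_neg (by omega)]
    exact Finset.sum_eq_zero fun j _ => if_neg (by omega)

end GaudinParameters

/-! ### Fields with values in the Lie algebra -/

section LieValued

variable (A 𝔤 : Type*) [CommRing A] [Algebra ℂ A] [LieRing 𝔤] [LieAlgebra ℂ 𝔤]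

/-- The bilinear form `κ`, the opposite of the Killing form, on `𝔤`. -/
def kappa : LinearMap.BilinForm ℂ 𝔤 := -(killingForm ℂ 𝔤)

/-- The extension of `κ` to a bilinear form on the `𝔤`-valued fields `A ⊗ 𝔤`. -/
def kappaA : LinearMap.BilinForm A (A ⊗[ℂ] 𝔤) := LinearMap.BilinForm.baseChange A (kappa 𝔤)

variable {A 𝔤}

/-- The component `κ(Y, F)` of a `𝔤`-valued field `F`. -/
def comp (Y : 𝔤) (F : A ⊗[ℂ] 𝔤) : A := kappaA A 𝔤 (1 ⊗ₜ[ℂ] Y) F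

end LieValued

/-! ### Realisations of affine Gaudin models -/

section Realisation

variable {A 𝔤 S : Type*} [CommRing A] [Algebra ℂ A] [LieRing 𝔤] [LieAlgebra ℂ 𝔤]

open Polynomial in
/-- A Takiff realisation: `𝔤`-valued fields `J α p` in `A` (only those with `p < m α` matter) with
the brackets
`{J^α_p(x)_1, J^β_q(y)_2} = δ_{αβ} ([C_12, J^α_{p+q}(x)_1] δ(x-y) - ℓ^α_{p+q} C_12 ∂_x δ(x-y))`
if `p + q < m α`, and zero otherwise. They are written here in components, i.e. contracted with
`Y ∈ 𝔤` in the first and `Z ∈ 𝔤` in the second tensor factor by means of `κ`. -/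
structure TakiffRealisation (P : GaudinParameters S) (V : PoissonVertexAlgebra A)
    (𝔤 : Type*) [LieRing 𝔤] [LieAlgebra ℂ 𝔤] where
  J : S → ℕ → A ⊗[ℂ] 𝔤
  bracket_same : ∀ (α : S) (p q : ℕ), p < P.m α → q < P.m α → p + q < P.m α → ∀ Y Z : 𝔤,
    V.bracket (comp Y (J α p)) (comp Z (J α q)) =
      C (comp ⁅Y, Z⁆ (J α (p + q))) + C (algebraMap ℂ A (P.ℓ α (p + q) * kappa 𝔤 Y Z)) * X
  bracket_same_zero : ∀ (α : S) (p q : ℕ), p < P.m α → q < P.m α → P.m α ≤ p + q → ∀ Y Z : 𝔤,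
    V.bracket (comp Y (J α p)) (comp Z (J α q)) = 0
  bracket_ne : ∀ (α β : S) (p q : ℕ), α ≠ β → p < P.m α → q < P.m β → ∀ Y Z : 𝔤,
    V.bracket (comp Y (J α p)) (comp Z (J β q)) = 0

namespace TakiffRealisation

variable {P : GaudinParameters S} {V : PoissonVertexAlgebra A} (R : TakiffRealisation P V 𝔤)

/-- The density of the generalised Segal-Sugawara integral `D^α_[p]`. -/
def segalSugawara (α : S) (p : ℕ) : A :=
  (1 / 2 : ℂ) • ∑ q ∈ Finset.range (P.m α), ∑ r ∈ Finset.range (P.m α),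
    if p ≤ q + r then P.k α (q + r - p) • kappaA A 𝔤 (R.J α q) (R.J α r) else 0

variable [Fintype S]

/-- The density of the momentum `∑_α D^α_[0]`. -/
def momentumDensity : A := ∑ α, R.segalSugawara α 0

/-- A realisation is suitable if `∑_α D^α_[0]` is the momentum of the algebra `A`, i.e. its
Hamiltonian flow is the spatial derivative. -/
def IsSuitable : Prop := ∀ f : A, (V.bracket R.momentumDensity f).coeff 0 = V.D f

/-- The Gaudin Lax matrix `Γ(z) = ∑_α ∑_p J α p / (z - z_α) ^ (p + 1)`, a `𝔤`-valued field
depending rationally on `z`. -/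
def gaudinLax : (RatFunc ℂ ⊗[ℂ] A) ⊗[ℂ] 𝔤 :=
  ∑ α, ∑ p ∈ Finset.range (P.m α), (P.pole α p ⊗ₜ[ℂ] (1 : A)) •
    LinearMap.rTensor 𝔤
      (Algebra.TensorProduct.includeRight : A →ₐ[ℂ] RatFunc ℂ ⊗[ℂ] A).toLinearMap (R.J α p)

/-- The density `- res_{z = c} κ(Γ(z), Γ(z)) / (2 φ(z)) dz` of the quadratic charge at the point
`c` of the Riemann sphere. -/
def q (c : OnePoint ℂ) : A :=
  -residueAtA A c
    (((2 * P.twist)⁻¹ ⊗ₜ[ℂ] (1 : A)) * kappaA (RatFunc ℂ ⊗[ℂ] A) 𝔤 R.gaudinLax R.gaudinLax)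

/-- The constraint `𝒞 = - res_{z = ∞} Γ(z) dz = ∑_α J α 0`. -/
def constraint : A ⊗[ℂ] 𝔤 := ∑ α, R.J α 0

/-- The ideal of the fields vanishing weakly: it is generated by the components of the constraint
and all their spatial derivatives. -/
def weakIdeal : Ideal A :=
  Ideal.span {f | ∃ (n : ℕ) (Y : 𝔤), f = (V.D)^[n] (comp Y R.constraint)}

/-- Weak equality of fields. -/
def WeakEq (f g : A) : Prop := f - g ∈ R.weakIdeal

variable {ι : Type*} [Fintype ι] (I : Module.Basis ι ℂ 𝔤)

/-- The time derivative of a field `O` of `A` under the flow of the total Hamiltonian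
`∫ h + ∫ κ(μ, 𝒞)`, i.e. `{∫ h, O} + ∫ dy κ(μ(y), {𝒞(y), O})`. The multiplier `μ = ∑ μ_a I^a` is an
independent auxiliary field: the variable `X (a, n)` stands for the `n`-th spatial derivative of
`μ_a`, and the values are polynomials in these variables. -/
def timeDeriv (h O : A) : MvPolynomial (ι × ℕ) A :=
  MvPolynomial.C ((V.bracket h O).coeff 0) +
    ∑ a, (V.bracket (comp (I a) R.constraint) O).sum
      fun n c => MvPolynomial.X (a, n) * MvPolynomial.C c

variable {M : ℕ} (ζ : Fin M → OnePoint ℂ) (ε : Fin M → ℂ)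

/-- The density of the first-class Hamiltonian `∑_i ε_i Q_i`. -/
def hamiltonianDensity : A := ∑ i, ε i • R.q (ζ i)

/-- `T μ ν` is the mixed tensor `T^μ_ν`, with index `0` for time and `1` for space. It is an
energy-momentum tensor of the model if `T^0_0` and `T^0_1` are the densities of the Hamiltonian and
of the momentum, and `∂_t T^0_ν + ∂_x T^1_ν` vanishes weakly. -/
structure IsEnergyMomentumTensor (T : Fin 2 → Fin 2 → A) : Prop where
  energy : R.WeakEq (T 0 0) (R.hamiltonianDensity ζ ε)
  momentum : R.WeakEq (T 0 1) R.momentumDensity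
  conservation : ∀ ν, R.timeDeriv I (R.hamiltonianDensity ζ ε) (T 0 ν) +
    MvPolynomial.C (V.D (T 1 ν)) ∈ R.weakIdeal.map (MvPolynomial.C (σ := ι × ℕ))

/-- The Minkowski metric with signature `(+1, -1)`. -/
def minkowski : Matrix (Fin 2) (Fin 2) ℂ := Matrix.diagonal ![1, -1]

/-- The tensor `T_{μν} = η_{μρ} T^ρ_ν`. -/
def lowered (T : Fin 2 → Fin 2 → A) (μ ν : Fin 2) : A := ∑ ρ, minkowski μ ρ • T ρ ν

/-- The model is relativistic: it has an energy-momentum tensor for which `T_{μν}` is (weakly)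
symmetric. -/
def IsRelativistic : Prop :=
  ∃ T, R.IsEnergyMomentumTensor I ζ ε T ∧ ∀ μ ν, R.WeakEq (lowered T μ ν) (lowered T ν μ)

end TakiffRealisation

end Realisation

end AffineGaudin

end

open AffineGaudin

/-! The proof diagonalises the quadratic charges in a current algebra. The Takiff fields are
collected into currents `J a s`, where `a` labels an orthonormal basis of the Lie algebra and `s` is
a family of power series at the sites, that is, the germ along the sites of a function of z. Their
brackets are those of a current algebra with central term `ℓ (s * t)`, where `ℓ s` is the sum over
the sites of the residues of s φ dz. The constraint is the current of `1`, and it is first class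
because `ℓ 1` is the sum of the levels ℓ_0.

To a zero ζ_i of φ dz is attached the germ u_i = 1/(ζ_i - z), or u_i = z at infinity. At a finite
zero, ℓ(u_i) = φ(ζ_i) = 0, and ℓ(u_i²) = -φ'(ζ_i) is non-zero because the zero is simple; infinity
behaves in the same way. By partial fractions u_i u_j lies in the span of 1, u_i, u_j, hence ℓ(u_i
u_j) = 0 for i ≠ j. A residue computation shows that q_i is weakly κ(J(u_i), J(u_i)) / (2 ℓ(u_i²))
(`exists_q_eq_charge`). In the bracket of ∫ q_i with q_j the central part gives δ_ij ∂_x q_j, and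
the cubic part is an alternating product of u_j, u_i and u_i u_j, hence weakly zero. So {∫ q_i, q_j}
≈ δ_ij ∂_x q_j (`coeff_zero_bracket_charge`).

The momentum density is half the quadratic field dual to ℓ. A germ s orthogonal to 1 and to all u_i
defines, through t ↦ ℓ(s t), a rational function whose quotient by φ has no poles on the sphere; the
quotient is constant, and s acts as a multiple of 1 (`exists_dual_eq`). Completeness of this kind
yields 𝔭 ≈ ∑ q_i (`sum_form_sub_mem`).

The conservation laws then determine ∂_x T^1_ν (`conservation_iff`). Symmetry of the tensor forces ∑
(ε_i² - 1) ∂_x q_i ≈ 0, and the ∂_x q_i are independent modulo the constraint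
(`eq_zero_of_sum_mem`). -/

noncomputable section

namespace AffineGaudin

/-! ### Local Poisson brackets modulo an ideal stable under the spatial derivative -/

section Bracket

open Polynomial

variable {A : Type*} [CommRing A] [Algebra ℂ A]

theorem coeff_lamAddD_zero (D : Derivation ℂ A A) (p : A[X]) :
    (lamAddD D p).coeff 0 = D (p.coeff 0) := by
  have h : ∀ n, (p.sum fun n c => monomial n (D c)).coeff n = D (p.coeff n) := by
    intro n
    by_cases hn : p.coeff n = 0 <;> simp [Polynomial.sum_def, coeff_monomial, hn]
  simp [lamAddD, h]

theorem coeff_lamAddD_succ (D : Derivation ℂ A A) (p : A[X]) (n : ℕ) :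
    (lamAddD D p).coeff (n + 1) = p.coeff n + D (p.coeff (n + 1)) := by
  have h : ∀ n, (p.sum fun n c => monomial n (D c)).coeff n = D (p.coeff n) := by
    intro n
    by_cases hn : p.coeff n = 0 <;> simp [Polynomial.sum_def, coeff_monomial, hn]
  simp [lamAddD, h]

theorem lamAddD_mem_map_C {D : Derivation ℂ A A} {W : Ideal A} (hW : ∀ f ∈ W, D f ∈ W)
    {p : A[X]} (hp : p ∈ W.map (C : A →+* A[X])) : lamAddD D p ∈ W.map (C : A →+* A[X]) := by
  rw [Ideal.mem_map_C_iff] at hp ⊢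
  rintro (_ | n)
  · rw [coeff_lamAddD_zero]
    exact hW _ (hp 0)
  · rw [coeff_lamAddD_succ]
    exact W.add_mem (hp n) (hW _ (hp (n + 1)))

namespace PoissonVertexAlgebra

variable (V : PoissonVertexAlgebra A)

/-- Skew-symmetry expresses the reversed bracket through iterates of `lamAddD` on the coefficients,
and these iterates preserve the extension of an ideal stable under `D`. -/
theorem bracket_swap_mem {W : Ideal A} (hW : ∀ f ∈ W, V.D f ∈ W) {a b : A}
    (h : V.bracket a b ∈ W.map (C : A →+* A[X])) : V.bracket b a ∈ W.map (C : A →+* A[X]) := by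
  rw [V.skew a b]
  refine neg_mem (Submodule.sum_mem _ fun n hn => Ideal.mul_mem_left _ _ ?_)
  clear hn
  rw [Ideal.mem_map_C_iff] at h
  have h0 := Ideal.mem_map_of_mem (C : A →+* A[X]) (h n)
  -- The coefficient is decoupled from `n`, so that the induction runs over the number of iterations
  -- only.
  generalize C ((V.bracket a b).coeff n) = p at h0
  induction n with
  | zero => simpa using h0
  | succ k ih =>
    rw [Function.iterate_succ_apply']
    exact lamAddD_mem_map_C hW ih

/-- If the brackets of `a` with a family of fields vanish modulo an ideal containing the
family, so do the brackets of `a` with the differential ideal generated by the family. -/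
theorem bracket_span_mem {κ : Type*} (g : κ → A) {W : Ideal A} (hW : ∀ f ∈ W, V.D f ∈ W)
    (hgen : W = Ideal.span {f | ∃ (n : ℕ) (k : κ), f = (V.D)^[n] (g k)}) {a : A}
    (h : ∀ k, V.bracket a (g k) ∈ W.map (C : A →+* A[X])) {f : A} (hf : f ∈ W) :
    V.bracket a f ∈ W.map (C : A →+* A[X]) := by
  have hg : ∀ n k, V.bracket a ((V.D)^[n] (g k)) ∈ W.map (C : A →+* A[X]) := by
    intro n k
    induction n with
    | zero => simpa using h k
    | succ n ih =>
      rw [Function.iterate_succ_apply', V.bracket_D_right]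
      exact lamAddD_mem_map_C hW ih
  have hf' := hf
  rw [hgen] at hf'
  -- Membership of `f` itself is carried along: in the Leibniz rule for `c * x`, the term `x *
  -- bracket a c` is controlled only by `x ∈ W`.
  suffices f ∈ W ∧ V.bracket a f ∈ W.map (C : A →+* A[X]) from this.2
  clear hf
  induction hf' using Submodule.span_induction with
  | mem x hx =>
    obtain ⟨n, k, rfl⟩ := hx
    refine ⟨?_, hg n k⟩
    rw [hgen]
    exact Ideal.subset_span ⟨n, k, rfl⟩
  | zero => simp
  | add x y _ _ hx hy =>
    rw [map_add]
    exact ⟨add_mem hx.1 hy.1, add_mem hx.2 hy.2⟩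
  | smul c x _ hx =>
    rw [smul_eq_mul, V.leibniz]
    exact ⟨W.mul_mem_left _ hx.1, add_mem (Ideal.mul_mem_left _ _ hx.2)
      (Ideal.mul_mem_right _ _ (Ideal.mem_map_of_mem _ hx.1))⟩

theorem D_mem_span {κ : Type*} (g : κ → A) {f : A}
    (hf : f ∈ Ideal.span {f | ∃ (n : ℕ) (k : κ), f = (V.D)^[n] (g k)}) :
    V.D f ∈ Ideal.span {f | ∃ (n : ℕ) (k : κ), f = (V.D)^[n] (g k)} := by
  induction hf using Submodule.span_induction with
  | mem x hx =>
    obtain ⟨n, k, rfl⟩ := hx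
    exact Ideal.subset_span ⟨n + 1, k, by rw [Function.iterate_succ_apply']⟩
  | zero => simp
  | add x y _ _ hx hy => rw [map_add]; exact add_mem hx hy
  | smul c x hx' hx =>
    rw [smul_eq_mul, Derivation.leibniz]
    exact add_mem (Ideal.mul_mem_left _ _ hx) (Ideal.mul_mem_right _ _ hx')

/-- The coefficient of `lam ^ k` in the bracket with `a`, as a derivation. -/
def coeffDerivation (a : A) (k : ℕ) : Derivation ℂ A A :=
  Derivation.mk' (((lcoeff A k).restrictScalars ℂ).comp (V.bracket a)) fun b c => by
    simp [V.leibniz]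

@[simp]
theorem coeffDerivation_apply (a : A) (k : ℕ) (f : A) :
    V.coeffDerivation a k f = (V.bracket a f).coeff k := rfl

/-- Each `D` in the second argument acts as `lam + D` and raises the degree in `lam` by at most one;
`d` is a strict bound on the initial degree. -/
theorem coeff_bracket_iterate_D_of_lt {a f : A} {d : ℕ}
    (h : ∀ k, d ≤ k → (V.bracket a f).coeff k = 0)
    (n k : ℕ) (hk : n + d ≤ k) : (V.bracket a ((V.D)^[n] f)).coeff k = 0 := by
  induction n generalizing k with
  | zero => exact h k (by omega)
  | succ n ih =>
    obtain ⟨k, rfl⟩ : ∃ j, k = j + 1 := ⟨k - 1, by omega⟩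
    rw [Function.iterate_succ_apply', V.bracket_D_right, coeff_lamAddD_succ, ih k (by omega),
      ih (k + 1) (by omega), map_zero, add_zero]

/-- The top coefficient of `(lam + D) ^ n` applied to a polynomial is the original top coefficient.
Through it a bracket can detect a single derivative of a current. -/
theorem coeff_bracket_iterate_D {a f : A} {d : ℕ} (h : ∀ k, d < k → (V.bracket a f).coeff k = 0)
    (n : ℕ) : (V.bracket a ((V.D)^[n] f)).coeff (n + d) = (V.bracket a f).coeff d := by
  induction n with
  | zero => simp
  | succ n ih =>
    rw [Function.iterate_succ_apply', V.bracket_D_right, add_right_comm, coeff_lamAddD_succ, ih,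
      V.coeff_bracket_iterate_D_of_lt (d := d + 1) (fun k hk => h k hk) n _ (by omega), map_zero,
      add_zero]

end PoissonVertexAlgebra

end Bracket

/-! ### Current algebras -/

section Currents

open Polynomial

/-- Fields `J a s`, depending linearly on an element `s` of a commutative algebra `T`, with the
brackets of a current algebra with values in `𝔤 ⊗ T`, where `𝔤` has structure constants `f` in an
orthonormal basis, and with central term given by the linear form `ℓ` on `T`. -/
structure CurrentAlgebra {A : Type*} [CommRing A] [Algebra ℂ A] (V : PoissonVertexAlgebra A)
    (T n : Type*) [CommRing T] [Algebra ℂ T] [Fintype n] [DecidableEq n] where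
  J : n → T →ₗ[ℂ] A
  ℓ : T →ₗ[ℂ] ℂ
  f : n → n → n → ℂ
  f_swap_left : ∀ a b c, f a b c = -f b a c
  f_swap_right : ∀ a b c, f a b c = -f a c b
  bracket_J : ∀ a b s t, V.bracket (J a s) (J b t) =
    C (∑ c, f a b c • J c (s * t)) + C (algebraMap ℂ A (if a = b then ℓ (s * t) else 0)) * X

namespace CurrentAlgebra

variable {A : Type*} [CommRing A] [Algebra ℂ A] {V : PoissonVertexAlgebra A}
  {T n : Type*} [CommRing T] [Algebra ℂ T] [Fintype n] [DecidableEq n]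
  (K : CurrentAlgebra V T n)

/-- The ideal generated by the fields `J a 1` and their derivatives. -/
def weakIdeal : Ideal A := Ideal.span {f | ∃ (k : ℕ) (a : n), f = (V.D)^[k] (K.J a 1)}

theorem D_mem_weakIdeal {f : A} (hf : f ∈ K.weakIdeal) : V.D f ∈ K.weakIdeal :=
  V.D_mem_span (fun a => K.J a 1) hf

theorem J_one_mem (a : n) : K.J a 1 ∈ K.weakIdeal := Ideal.subset_span ⟨0, a, rfl⟩

/-- The contraction of `J s` and `J t` with the invariant form. -/
def form (s t : T) : A := ∑ a, K.J a s * K.J a t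

theorem form_one_mem (t : T) : K.form 1 t ∈ K.weakIdeal :=
  Submodule.sum_mem _ fun a _ => K.weakIdeal.mul_mem_right _ (K.J_one_mem a)

/-- The component `b` of the Lie bracket of `J s` and `J t`. -/
def cross (b : n) (s : T) : T →ₗ[ℂ] A :=
  ∑ a, ∑ c, K.f b a c • (LinearMap.mulLeft ℂ (K.J a s)).comp (K.J c)

theorem cross_apply (b : n) (s t : T) :
    K.cross b s t = ∑ a, ∑ c, K.f b a c • (K.J a s * K.J c t) := by
  simp [cross]

theorem cross_swap (b : n) (s t : T) : K.cross b s t = -K.cross b t s := by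
  rw [cross_apply, cross_apply, Finset.sum_comm, ← Finset.sum_neg_distrib]
  refine Finset.sum_congr rfl fun a _ => ?_
  rw [← Finset.sum_neg_distrib]
  refine Finset.sum_congr rfl fun c _ => ?_
  rw [K.f_swap_right, neg_smul, mul_comm]

theorem eq_zero_of_eq_neg {x : A} (h : x = -x) : x = 0 := by
  have h2 : (2 : ℂ) • x = 0 := by
    rw [two_smul]; nth_rw 1 [h]; exact neg_add_cancel x
  simpa using congrArg (fun y => (2⁻¹ : ℂ) • y) h2

theorem cross_self (b : n) (s : T) : K.cross b s s = 0 :=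
  eq_zero_of_eq_neg (K.cross_swap b s s)

/-- The triple product of `J t`, `J s` and `J r`. -/
def triple (t s r : T) : A := ∑ b, K.J b t * K.cross b s r

theorem triple_self_right (t s : T) : K.triple t s s = 0 := by
  simp [triple, cross_self]

theorem triple_swap_left (t s r : T) : K.triple t s r = -K.triple s t r := by
  have h : ∀ t s : T, K.triple t s r =
      ∑ b, ∑ a, ∑ c, K.f b a c • (K.J b t * (K.J a s * K.J c r)) := by
    intro t s
    simp [triple, cross_apply, Finset.mul_sum]
  rw [h, h, ← Finset.sum_neg_distrib, Finset.sum_comm]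
  refine Finset.sum_congr rfl fun a _ => ?_
  rw [← Finset.sum_neg_distrib]
  refine Finset.sum_congr rfl fun b _ => ?_
  rw [← Finset.sum_neg_distrib]
  refine Finset.sum_congr rfl fun c _ => ?_
  rw [K.f_swap_left, neg_smul, mul_left_comm]

theorem triple_self_left (s r : T) : K.triple s s r = 0 :=
  eq_zero_of_eq_neg (K.triple_swap_left s s r)

theorem triple_self_outer (t s : T) : K.triple t s t = 0 := by
  have h : K.triple t s t = -K.triple t t s := by
    simp only [triple, ← Finset.sum_neg_distrib, ← mul_neg, ← cross_swap]
  rw [h, triple_self_left, neg_zero]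

theorem triple_one_right_mem (t s : T) : K.triple t s 1 ∈ K.weakIdeal := by
  refine Submodule.sum_mem _ fun b _ => K.weakIdeal.mul_mem_left _ ?_
  rw [cross_apply]
  refine Submodule.sum_mem _ fun a _ => Submodule.sum_mem _ fun c _ => ?_
  rw [← mul_smul_comm, Algebra.smul_def]
  exact K.weakIdeal.mul_mem_left _ (K.weakIdeal.mul_mem_left _ (K.J_one_mem c))

theorem bracket_J_form_self (b : n) (s t : T) : V.bracket (K.J b t) (K.form s s) =
    C ((2 : ℂ) • K.cross b s (t * s)) + C ((2 * K.ℓ (t * s)) • K.J b s) * X := by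
  have h : ∀ a, V.bracket (K.J b t) (K.J a s * K.J a s) =
      C ((2 : ℂ) • ∑ c, K.f b a c • (K.J a s * K.J c (t * s))) +
        (if b = a then C ((2 * K.ℓ (t * s)) • K.J b s) * X else 0) := by
    intro a
    rw [V.leibniz, K.bracket_J, two_smul]
    have h1 : C (K.J a s) * C (∑ c, K.f b a c • K.J c (t * s)) =
        C (∑ c, K.f b a c • (K.J a s * K.J c (t * s))) := by
      rw [← C_mul, Finset.mul_sum]
      simp only [mul_smul_comm]
    rw [mul_add, h1, C_add]
    split_ifs with hab
    · subst hab
      rw [mul_smul, two_smul, Algebra.smul_def]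
      simp only [C_add, C_mul]
      ring
    · simp
  rw [form, map_sum, Finset.sum_congr rfl fun a _ => h a, Finset.sum_add_distrib,
    Finset.sum_ite_eq, if_pos (Finset.mem_univ b), cross_apply, Finset.smul_sum, map_sum]

theorem coeff_zero_bracket_swap {a b p q : A} (h : V.bracket a b = C p + C q * X) :
    (V.bracket b a).coeff 0 = V.D q - p := by
  have hs := V.skew a b
  have hd : (V.bracket a b).natDegree < 2 := by
    rw [h, add_comm]
    exact Nat.lt_succ_of_le natDegree_linear_le
  -- The degree is at most one, so skew-symmetry leaves only the terms `-p` and `(lam + D) q`.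
  rw [Polynomial.sum_over_range' _ (by
    intro k
    have h0 : ∀ k : ℕ, (lamAddD V.D)^[k] (0 : A[X]) = 0 := by
      intro k
      induction k with
      | zero => rfl
      | succ k ih => rw [Function.iterate_succ_apply', ih]; simp [lamAddD]
    rw [map_zero, h0, mul_zero]) 2 hd] at hs
  rw [hs, h]
  simp [Finset.sum_range_succ, coeff_lamAddD_zero]
  ring

/-- This identity governs all brackets of charges: the first term is central and becomes a total
derivative for `s = t`; the second is the cubic obstruction to commutation. -/
theorem coeff_zero_bracket_form_form (s t : T) : (V.bracket (K.form s s) (K.form t t)).coeff 0 =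
    (4 * K.ℓ (t * s)) • ∑ b, K.J b t * V.D (K.J b s) - (4 : ℂ) • K.triple t s (t * s) := by
  have h : ∀ b, (V.bracket (K.form s s) (K.J b t)).coeff 0 =
      (2 * K.ℓ (t * s)) • V.D (K.J b s) - (2 : ℂ) • K.cross b s (t * s) := fun b => by
    rw [coeff_zero_bracket_swap (K.bracket_J_form_self b s t), Derivation.map_smul]
  conv_lhs => rw [form.eq_1 K t t]
  rw [map_sum, finsetSum_coeff, triple, Finset.smul_sum, Finset.smul_sum,
    ← Finset.sum_sub_distrib]
  refine Finset.sum_congr rfl fun b _ => ?_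
  rw [V.leibniz, coeff_add, coeff_C_mul, h, ← mul_add, ← two_smul ℂ, smul_sub, smul_smul,
    smul_smul, mul_sub, mul_smul_comm, mul_smul_comm]
  congr 2 <;> ring

/-! #### The constraint is first class -/

/-- Between two constraints the central term is `ℓ 1`; once it vanishes, only constraints remain on
the right. -/
theorem bracket_J_one_mem (h1 : K.ℓ 1 = 0) (a : n) {f : A} (hf : f ∈ K.weakIdeal) :
    V.bracket (K.J a 1) f ∈ K.weakIdeal.map (C : A →+* A[X]) := by
  refine V.bracket_span_mem (fun b => K.J b 1) (fun _ => K.D_mem_weakIdeal) rfl (fun b => ?_) hf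
  rw [K.bracket_J, mul_one, h1, ite_self, map_zero, map_zero, zero_mul, add_zero]
  refine Ideal.mem_map_of_mem _ (Submodule.sum_mem _ fun c _ => ?_)
  rw [Algebra.smul_def]
  exact K.weakIdeal.mul_mem_left _ (K.J_one_mem c)

/-- The brackets of a first-class field preserve the ideal. -/
theorem bracket_mem_of_firstClass {g : A}
    (hg : ∀ a, V.bracket (K.J a 1) g ∈ K.weakIdeal.map (C : A →+* A[X])) {f : A}
    (hf : f ∈ K.weakIdeal) : V.bracket g f ∈ K.weakIdeal.map (C : A →+* A[X]) :=
  V.bracket_span_mem (fun b => K.J b 1) (fun _ => K.D_mem_weakIdeal) rfl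
    (fun a => V.bracket_swap_mem (fun _ => K.D_mem_weakIdeal) (hg a)) hf

/-! #### Quadratic charges -/

/-- A quadratic field, up to a term vanishing weakly. -/
def charge (u v : T) (b : ℂ) : A := (b / 2) • K.form u u + K.form 1 v

/-- A family of elements of `T` that are orthogonal to each other and to `1` for the bilinear form
`ℓ (s * t)`. -/
structure IsOrthogonalFamily {ι : Type*} (u : ι → T) (b : ι → ℂ) : Prop where
  ℓ_one : K.ℓ 1 = 0
  ℓ_eq_zero : ∀ i, K.ℓ (u i) = 0
  norm : ∀ i, b i * K.ℓ (u i * u i) = 1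
  orthogonal : ∀ i j, i ≠ j → K.ℓ (u i * u j) = 0
  mul_mem : ∀ i j, i ≠ j → ∃ x y z : ℂ, u i * u j = x • 1 + y • u i + z • u j

theorem charge_sub_mem (u v : T) (b : ℂ) :
    K.charge u v b - (b / 2) • K.form u u ∈ K.weakIdeal := by
  rw [charge, add_sub_cancel_left]
  exact K.form_one_mem v

/-- Gauge invariance of the quadratic part: its Lie bracket term `cross` vanishes by antisymmetry
and its central term is proportional to `ℓ u`. The rest of the charge is already in the ideal. -/
theorem bracket_J_one_charge (h1 : K.ℓ 1 = 0) {u : T} (hu : K.ℓ u = 0) (v : T) (b : ℂ) (a : n) :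
    V.bracket (K.J a 1) (K.charge u v b) ∈ K.weakIdeal.map (C : A →+* A[X]) := by
  rw [charge, map_add, map_smul, K.bracket_J_form_self, one_mul, hu, cross_self]
  simpa using K.bracket_J_one_mem h1 a (K.form_one_mem v)

theorem smul_mem_weakIdeal (c : ℂ) {f : A} (hf : f ∈ K.weakIdeal) : c • f ∈ K.weakIdeal := by
  rw [Algebra.smul_def]
  exact K.weakIdeal.mul_mem_left _ hf

namespace IsOrthogonalFamily

variable {K} {ι : Type*} {u : ι → T} {b : ι → ℂ} (hu : K.IsOrthogonalFamily u b)
include hu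

/-- The triple product is alternating, so in the expansion of `u j * u i` over `1`, `u j`, `u i`
only the term along `1` survives, and that one contains a constraint. -/
theorem triple_mem {i j : ι} (h : i ≠ j) : K.triple (u j) (u i) (u j * u i) ∈ K.weakIdeal := by
  obtain ⟨x, y, z, hxyz⟩ := hu.mul_mem j i h.symm
  have : K.triple (u j) (u i) (u j * u i) = x • K.triple (u j) (u i) 1 +
      y • K.triple (u j) (u i) (u j) + z • K.triple (u j) (u i) (u i) := by
    simp only [hxyz, triple, map_add, map_smul, mul_add, Finset.sum_add_distrib, mul_smul_comm,
      Finset.smul_sum]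
  rw [this, triple_self_outer, triple_self_right, smul_zero, smul_zero, add_zero, add_zero]
  exact K.smul_mem_weakIdeal x (K.triple_one_right_mem _ _)

/-- The charges commute weakly, and each of them is its own momentum density. -/
theorem coeff_zero_bracket_charge [DecidableEq ι] (v : ι → T) (i j : ι) :
    (V.bracket (K.charge (u i) (v i) (b i)) (K.charge (u j) (v j) (b j))).coeff 0 -
      (if i = j then V.D (K.charge (u j) (v j) (b j)) else 0) ∈ K.weakIdeal := by
  -- With `v = 0` the charge is the pure quadratic form. Both versions are first class, so `e1` and
  -- `e2` replace each argument of the bracket in turn by its quadratic part.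
  have hC := fun i => K.bracket_J_one_charge hu.ℓ_one (hu.ℓ_eq_zero i) 0 (b i)
  simp only [charge] at hC
  have h0 : K.form 1 0 = 0 := by simp [form]
  simp only [h0, add_zero] at hC
  have hC' := fun i => K.bracket_J_one_charge hu.ℓ_one (hu.ℓ_eq_zero i) (v i) (b i)
  have e1 := K.bracket_mem_of_firstClass (hC i) (K.charge_sub_mem (u j) (v j) (b j))
  have e2 := V.bracket_swap_mem (fun _ => K.D_mem_weakIdeal)
    (K.bracket_mem_of_firstClass (hC' j) (K.charge_sub_mem (u i) (v i) (b i)))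
  rw [Ideal.mem_map_C_iff] at e1 e2
  have e1 := e1 0
  have e2 := e2 0
  have e3 : (V.bracket ((b i / 2) • K.form (u i) (u i))
      ((b j / 2) • K.form (u j) (u j))).coeff 0 -
      (if i = j then V.D ((b j / 2) • K.form (u j) (u j)) else 0) ∈ K.weakIdeal := by
    rw [map_smul, map_smul, LinearMap.smul_apply, smul_smul, coeff_smul,
      coeff_zero_bracket_form_form]
    split_ifs with h
    · subst h
      have : (b i / 2 * (b i / 2)) • ((4 * K.ℓ (u i * u i)) • ∑ a, K.J a (u i) * V.D (K.J a (u i)) -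
          (4 : ℂ) • K.triple (u i) (u i) (u i * u i)) = V.D ((b i / 2) • K.form (u i) (u i)) := by
        rw [triple_self_left, smul_zero, sub_zero, smul_smul, Derivation.map_smul, form, map_sum]
        -- The normalisation `b i * ℓ (u i * u i) = 1` is what makes each charge generate its own
        -- translation with coefficient one.
        have : b i / 2 * (b i / 2) * (4 * K.ℓ (u i * u i)) = b i / 2 * 2 := by
          linear_combination b i * hu.norm i
        rw [this, mul_smul, Finset.smul_sum]
        congr 1
        refine Finset.sum_congr rfl fun a _ => ?_
        rw [Derivation.leibniz, smul_eq_mul, two_smul]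
      rw [this, sub_self]
      exact K.weakIdeal.zero_mem
    · rw [hu.orthogonal j i (Ne.symm h), mul_zero, zero_smul, zero_sub, sub_zero]
      exact K.smul_mem_weakIdeal _ (neg_mem (K.smul_mem_weakIdeal _ (hu.triple_mem h)))
  have e4 : (if i = j then V.D ((b j / 2) • K.form (u j) (u j)) else 0) -
      (if i = j then V.D (K.charge (u j) (v j) (b j)) else 0) ∈ K.weakIdeal := by
    split_ifs
    · rw [← map_sub, ← neg_sub, map_neg]
      exact neg_mem (K.D_mem_weakIdeal (K.charge_sub_mem _ _ _))
    · simp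
  have := add_mem (add_mem e1 e2) (add_mem e3 e4)
  simp only [map_sub, LinearMap.sub_apply, coeff_sub] at this
  convert this using 1
  ring

/-! #### Independence of the charges -/

end IsOrthogonalFamily

end CurrentAlgebra

end Currents

/-! ### Independence of the derivatives of the charges modulo the constraint ideal. -/

section Currents

open Polynomial

namespace CurrentAlgebra

variable {A : Type*} [CommRing A] [Algebra ℂ A] {V : PoissonVertexAlgebra A}
  {T n : Type*} [CommRing T] [Algebra ℂ T] [Fintype n] [DecidableEq n]
  (K : CurrentAlgebra V T n)

theorem coeff_one_bracket_J (a b : n) (s t : T) : (V.bracket (K.J a s) (K.J b t)).coeff 1 =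
    algebraMap ℂ A (if a = b then K.ℓ (s * t) else 0) := by
  rw [K.bracket_J]
  simp [coeff_C]

theorem coeff_bracket_J (a b : n) (s t : T) (k : ℕ) (hk : 1 < k) :
    (V.bracket (K.J a s) (K.J b t)).coeff k = 0 := by
  obtain ⟨k, rfl⟩ : ∃ j, k = j + 1 := ⟨k - 1, by omega⟩
  rw [K.bracket_J, coeff_add, coeff_C_mul_X, coeff_C, if_neg (by omega), if_neg (by omega),
    add_zero]

theorem derivation_sum_apply {κ : Type*} (t : Finset κ) (X : κ → Derivation ℂ A A) (f : A) :
    (∑ i ∈ t, X i) f = ∑ i ∈ t, X i f := by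
  rw [← Derivation.coeFnAddMonoidHom_apply, map_sum, Finset.sum_apply]
  rfl

/-- A derivation can be corrected, without changing its values on low derivatives of the currents,
so that it annihilates arbitrarily high derivatives of the constraint. -/
theorem exists_correction {w : T} (hw : K.ℓ w = 1) (X : Derivation ℂ A A) (d : ℕ)
    (hX : ∀ k < d, ∀ a, X ((V.D)^[k] (K.J a 1)) = 0) (N : ℕ) :
    ∃ E : Derivation ℂ A A, (∀ k < d, ∀ a t, E ((V.D)^[k] (K.J a t)) = 0) ∧
      ∀ k < N, ∀ a, (X - E) ((V.D)^[k] (K.J a 1)) = 0 := by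
  induction N with
  | zero => exact ⟨0, by simp, by simp⟩
  | succ N ih =>
    obtain ⟨E, hE, hXE⟩ := ih
    rcases lt_or_ge N d with hN | hN
    · exact ⟨E, hE, fun k hk a => by simp [hX k (by omega), hE k (by omega)]⟩
    · have hlow : ∀ k < N, ∀ a b t,
          (V.bracket (K.J b w) ((V.D)^[k] (K.J a t))).coeff (N + 1) = 0 := fun k hk a b t =>
        V.coeff_bracket_iterate_D_of_lt (d := 2) (fun j hj => K.coeff_bracket_J b a w t j hj) k _
          (by omega)
      -- The coefficient of `lam ^ (N + 1)` in the bracket with `J b w` vanishes on all derivatives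
      -- of currents of order below `N`, and on the `N`-th derivative of `J a 1` it is `1` if `a =
      -- b` and `0` otherwise, since `ℓ w = 1`. These derivations therefore remove the values at
      -- order `N` without disturbing the lower ones.
      refine ⟨E + ∑ b, (X - E) ((V.D)^[N] (K.J b 1)) • V.coeffDerivation (K.J b w) (N + 1),
        fun k hk a t => ?_, fun k hk a => ?_⟩
      · simp [derivation_sum_apply, hE k hk, hlow k (by omega)]
      · rw [← sub_sub, Derivation.sub_apply, derivation_sum_apply]
        simp only [Derivation.smul_apply, PoissonVertexAlgebra.coeffDerivation_apply, smul_eq_mul]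
        rcases Nat.lt_succ_iff_lt_or_eq.mp hk with hk | rfl
        · simp only [hlow k hk, mul_zero, Finset.sum_const_zero, sub_zero]
          exact hXE k hk a
        · have htop : ∀ b, (V.bracket (K.J b w) ((V.D)^[k] (K.J a 1))).coeff (k + 1) =
              if b = a then 1 else 0 := fun b => by
            rw [V.coeff_bracket_iterate_D (d := 1) (K.coeff_bracket_J b a w 1),
              coeff_one_bracket_J, mul_one, hw]
            split_ifs <;> simp
          simp [htop]

/-- An element of the ideal involves only finitely many derivatives of the constraint; a derivation
killing those maps it back into the ideal. -/
theorem exists_derivation_mem {f : A} (hf : f ∈ K.weakIdeal) : ∃ N, ∀ X : Derivation ℂ A A,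
    (∀ k < N, ∀ a, X ((V.D)^[k] (K.J a 1)) = 0) → X f ∈ K.weakIdeal := by
  unfold weakIdeal at hf
  induction hf using Submodule.span_induction with
  | mem x hx =>
    obtain ⟨k, a, rfl⟩ := hx
    refine ⟨k + 1, fun X hX => ?_⟩
    rw [hX k (by omega)]
    exact zero_mem _
  | zero => exact ⟨0, fun X _ => by simp⟩
  | add x y _ _ hx hy =>
    obtain ⟨N₁, h₁⟩ := hx
    obtain ⟨N₂, h₂⟩ := hy
    refine ⟨max N₁ N₂, fun X hX => ?_⟩
    rw [map_add]
    exact add_mem (h₁ X fun k hk => hX k (lt_max_of_lt_left hk))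
      (h₂ X fun k hk => hX k (lt_max_of_lt_right hk))
  | smul c x hx' hx =>
    obtain ⟨N, h⟩ := hx
    refine ⟨N, fun X hX => ?_⟩
    rw [smul_eq_mul, Derivation.leibniz]
    exact add_mem (Ideal.mul_mem_left _ _ (h X hX)) (Ideal.mul_mem_right _ _ hx')

/-- A general derivation does not preserve the ideal. The correction makes it applicable to a given
weak equality, while its values on low derivatives of the currents stay the same. -/
theorem exists_correction_mem {w : T} (hw : K.ℓ w = 1) {f : A} (hf : f ∈ K.weakIdeal)
    (X : Derivation ℂ A A) (d : ℕ) (hX : ∀ k < d, ∀ a, X ((V.D)^[k] (K.J a 1)) = 0) :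
    ∃ E : Derivation ℂ A A, (∀ k < d, ∀ a t, E ((V.D)^[k] (K.J a t)) = 0) ∧
      X f - E f ∈ K.weakIdeal := by
  obtain ⟨N, hN⟩ := K.exists_derivation_mem hf
  obtain ⟨E, hE, hXE⟩ := K.exists_correction hw X d hX N
  exact ⟨E, hE, hN (X - E) hXE⟩

theorem derivation_D_form (X : Derivation ℂ A A) (hX : ∀ a t, X (K.J a t) = 0) (s : T) :
    X (V.D (K.form s s)) = (2 : ℂ) • ∑ a, K.J a s * X (V.D (K.J a s)) := by
  rw [form, map_sum, map_sum, Finset.smul_sum]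
  refine Finset.sum_congr rfl fun a _ => ?_
  simp only [Derivation.leibniz, smul_eq_mul, map_add, hX, mul_zero, add_zero, two_smul]

/-- Two derivations built from brackets with `J β (u j)` isolate `c j`. The coefficient of `lam ^ 2`
kills the currents and sees only their first derivatives, which turns the sum into `c j • J β (u
j)`; the coefficient of `lam` then gives the scalar `c j * ℓ (u j * u j)`. The condition `ℓ (u j) =
0` allows both to be corrected so as to respect the ideal, and a non-zero scalar in the ideal
contradicts `hW`. -/
theorem IsOrthogonalFamily.eq_zero_of_sum_mem {K : CurrentAlgebra V T n} {ι : Type*} [Fintype ι]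
    {u : ι → T} {b : ι → ℂ} (hu : K.IsOrthogonalFamily u b) (v : ι → T) [Nonempty n]
    (hW : (1 : A) ∉ K.weakIdeal) (c : ι → ℂ)
    (hc : ∑ i, c i • V.D (K.charge (u i) (v i) (b i)) ∈ K.weakIdeal) (j : ι) : c j = 0 := by
  classical
  obtain ⟨β⟩ := ‹Nonempty n›
  -- The normalisation of the family supplies the element of level one that the corrections require.
  have hw : K.ℓ (b j • (u j * u j)) = 1 := by rw [map_smul, smul_eq_mul, hu.norm]
  have hc' : ∑ i, c i • V.D ((b i / 2) • K.form (u i) (u i)) ∈ K.weakIdeal := by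
    rw [← sub_sub_cancel (∑ i, c i • V.D (K.charge (u i) (v i) (b i)))
      (∑ i, c i • V.D ((b i / 2) • K.form (u i) (u i)))]
    refine sub_mem hc ?_
    rw [← Finset.sum_sub_distrib]
    refine sum_mem fun i _ => ?_
    rw [← smul_sub, ← map_sub]
    exact K.smul_mem_weakIdeal _ (K.D_mem_weakIdeal (K.charge_sub_mem _ _ _))
  have hval : ∀ (a : n) (i : ι), (V.bracket (K.J β (u j)) (K.J a (u i))).coeff 1 =
      if β = a ∧ j = i then algebraMap ℂ A (K.ℓ (u j * u j)) else 0 := by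
    intro a i
    rw [coeff_one_bracket_J]
    by_cases h1 : β = a <;> by_cases h2 : j = i
    · subst h2; simp [h1]
    · simp [h1, h2, hu.orthogonal j i h2]
    · simp [h1]
    · simp [h1]
  have hone : ∀ a, (V.bracket (K.J β (u j)) (K.J a 1)).coeff 1 = 0 := fun a => by
    rw [coeff_one_bracket_J, mul_one, hu.ℓ_eq_zero, ite_self, map_zero]
  have hsecond : c j • K.J β (u j) ∈ K.weakIdeal := by
    set X := V.coeffDerivation (K.J β (u j)) 2 with hXdef
    have hXJ : ∀ a t, X (K.J a t) = 0 := fun a t => K.coeff_bracket_J β a (u j) t 2 (by omega)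
    have hXD : ∀ a t, X (V.D (K.J a t)) = (V.bracket (K.J β (u j)) (K.J a t)).coeff 1 :=
      fun a t => V.coeff_bracket_iterate_D (d := 1) (K.coeff_bracket_J β a (u j) t) 1
    obtain ⟨E, hE, hXE⟩ := K.exists_correction_mem hw hc' X 2 (by
      intro k hk a
      interval_cases k
      · exact hXJ a 1
      · exact (hXD a 1).trans (hone a))
    have hEJ : ∀ a t, E (K.J a t) = 0 := hE 0 (by omega)
    have hED : ∀ a t, E (V.D (K.J a t)) = 0 := hE 1 (by omega)
    have h0 : E (∑ i, c i • V.D ((b i / 2) • K.form (u i) (u i))) = 0 := by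
      simp [map_sum, K.derivation_D_form E hEJ, hED]
    have h1 : X (∑ i, c i • V.D ((b i / 2) • K.form (u i) (u i))) = c j • K.J β (u j) := by
      simp only [map_sum, Derivation.map_smul, K.derivation_D_form X hXJ, hXD, hval]
      rw [Finset.sum_eq_single j, Finset.sum_eq_single β]
      · have : b j / 2 * (2 * K.ℓ (u j * u j)) = 1 := by linear_combination hu.norm j
        rw [if_pos ⟨rfl, rfl⟩, mul_comm (K.J β (u j)), ← Algebra.smul_def, smul_smul 2,
          smul_smul (b j / 2), this, one_smul]
      · intro a _ ha
        rw [if_neg (fun h => ha h.1.symm), mul_zero]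
      · simp
      · intro i _ hi
        rw [Finset.sum_eq_zero fun a _ => ?_, smul_zero, smul_zero, smul_zero]
        rw [if_neg (fun h => hi h.2.symm), mul_zero]
      · simp
    rwa [h0, h1, sub_zero] at hXE
  set X := V.coeffDerivation (K.J β (u j)) 1 with hXdef
  obtain ⟨E, hE, hXE⟩ := K.exists_correction_mem hw hsecond X 1 (by
    intro k hk a
    interval_cases k
    exact hone a)
  have hEJ : E (K.J β (u j)) = 0 := hE 0 (by omega) _ _
  rw [Derivation.map_smul, Derivation.map_smul, hEJ, smul_zero, sub_zero, hXdef,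
    PoissonVertexAlgebra.coeffDerivation_apply, hval, if_pos ⟨rfl, rfl⟩] at hXE
  by_contra hcj
  apply hW
  have := K.smul_mem_weakIdeal (b j * (c j)⁻¹) hXE
  rwa [smul_smul, mul_assoc, inv_mul_cancel₀ hcj, mul_one, Algebra.smul_def, ← map_mul, hu.norm,
    map_one] at this

end CurrentAlgebra

end Currents

/-! ### Orthonormal bases for the opposite of the Killing form -/

section Kappa

variable {𝔤 : Type*} [LieRing 𝔤] [LieAlgebra ℂ 𝔤]

theorem kappa_comm (x y : 𝔤) : kappa 𝔤 x y = kappa 𝔤 y x := by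
  simp [kappa, LieModule.traceForm_comm ℂ 𝔤 𝔤 x y]

theorem kappa_lie (x y z : 𝔤) : kappa 𝔤 ⁅x, y⁆ z = kappa 𝔤 x ⁅y, z⁆ := by
  simp [kappa, LieModule.traceForm_apply_lie_apply]

/-- A basis is orthonormal for `κ`. -/
def IsOrthonormal {n : Type*} [DecidableEq n] (e : Module.Basis n ℂ 𝔤) : Prop :=
  ∀ a b, kappa 𝔤 (e a) (e b) = if a = b then 1 else 0

/-- Semisimplicity makes the form non-degenerate, so the diagonal values on an orthogonal basis are
non-zero and can be rescaled to one by complex square roots. -/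
theorem exists_isOrthonormal [FiniteDimensional ℂ 𝔤] [LieAlgebra.IsSemisimple ℂ 𝔤] :
    ∃ e : Module.Basis (Fin (Module.finrank ℂ 𝔤)) ℂ 𝔤, IsOrthonormal e := by
  have hsymm : LinearMap.IsSymm (kappa 𝔤) := ⟨kappa_comm⟩
  have hnd : (kappa 𝔤).SeparatingLeft := fun x hx =>
    (LieAlgebra.IsKilling.killingForm_nondegenerate ℂ 𝔤).1 x fun y => by
      simpa [kappa] using hx y
  have : Invertible (2 : ℂ) := invertibleOfNonzero two_ne_zero
  obtain ⟨v, hv⟩ := LinearMap.BilinForm.exists_orthogonal_basis hsymm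
  have hne : ∀ a, kappa 𝔤 (v a) (v a) ≠ 0 := fun a =>
    hv.not_isOrtho_basis_self_of_separatingLeft hnd a
  choose c hc using fun a => IsAlgClosed.exists_pow_nat_eq (kappa 𝔤 (v a) (v a))⁻¹ two_pos
  have hc0 : ∀ a, c a ≠ 0 := fun a h0 => by
    have := hc a
    rw [h0, zero_pow two_ne_zero] at this
    exact inv_ne_zero (hne a) this.symm
  refine ⟨v.isUnitSMul fun a => (hc0 a).isUnit, fun a b => ?_⟩
  simp only [Module.Basis.isUnitSMul_apply, map_smul, LinearMap.smul_apply, smul_eq_mul]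
  split_ifs with h
  · subst h
    rw [← mul_assoc, ← pow_two, hc, inv_mul_cancel₀ (hne a)]
  · rw [show kappa 𝔤 (v a) (v b) = 0 from hv h, mul_zero, mul_zero]

namespace IsOrthonormal

variable {n : Type*} [Fintype n] [DecidableEq n] {e : Module.Basis n ℂ 𝔤} (he : IsOrthonormal e)
include he

theorem eq_sum (x : 𝔤) : x = ∑ a, kappa 𝔤 x (e a) • e a := by
  have h : ∀ a, kappa 𝔤 x (e a) = e.repr x a := by
    intro a
    conv_lhs => rw [← e.sum_repr x, map_sum, LinearMap.sum_apply]
    simp only [map_smul, LinearMap.smul_apply, he _ a]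
    simp
  simp_rw [h]
  exact (e.sum_repr x).symm

variable {A : Type*} [CommRing A] [Algebra ℂ A]

theorem comp_eq_sum (x : 𝔤) (F : A ⊗[ℂ] 𝔤) :
    comp x F = ∑ a, kappa 𝔤 x (e a) • comp (e a) F := by
  conv_lhs => rw [he.eq_sum x]
  simp only [comp, TensorProduct.tmul_sum, TensorProduct.tmul_smul, map_sum, LinearMap.sum_apply]
  refine Finset.sum_congr rfl fun a _ => ?_
  rw [← algebraMap_smul A (kappa 𝔤 x (e a)) ((1 : A) ⊗ₜ[ℂ] e a), map_smul, LinearMap.smul_apply,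
    algebraMap_smul]

theorem kappaA_eq_sum (F G : A ⊗[ℂ] 𝔤) :
    kappaA A 𝔤 F G = ∑ a, comp (e a) F * comp (e a) G := by
  induction F using TensorProduct.induction_on with
  | zero => simp [comp]
  | add x y hx hy =>
    rw [map_add, LinearMap.add_apply, hx, hy, ← Finset.sum_add_distrib]
    refine Finset.sum_congr rfl fun a _ => ?_
    simp only [comp, map_add, add_mul]
  | tmul c x =>
    have h1 : (c ⊗ₜ[ℂ] x : A ⊗[ℂ] 𝔤) = c • ((1 : A) ⊗ₜ[ℂ] x) := by
      rw [TensorProduct.smul_tmul', smul_eq_mul, mul_one]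
    have h2 : ∀ a, comp (e a) (c ⊗ₜ[ℂ] x : A ⊗[ℂ] 𝔤) = kappa 𝔤 x (e a) • c := fun a => by
      rw [kappa_comm, comp, kappaA, LinearMap.BilinForm.baseChange_tmul, one_mul]
    rw [h1, map_smul, LinearMap.smul_apply]
    change c • comp x G = _
    rw [he.comp_eq_sum x G, Finset.smul_sum]
    refine Finset.sum_congr rfl fun a _ => ?_
    rw [← h1, h2, smul_mul_assoc, smul_comm, smul_eq_mul]

end IsOrthonormal

end Kappa

/-! ### The currents of a Takiff realisation -/

section TruncatedProduct

/-- The product of two power series, truncated at order `m`. -/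
theorem sum_coeff_mul {M : Type*} [AddCommGroup M] [Module ℂ M] (m : ℕ) (s t : PowerSeries ℂ)
    (H : ℕ → M) : ∑ r ∈ Finset.range m, PowerSeries.coeff r (s * t) • H r =
      ∑ p ∈ Finset.range m, ∑ q ∈ Finset.range m,
        (PowerSeries.coeff p s * PowerSeries.coeff q t) • if p + q < m then H (p + q) else 0 := by
  have h : ∀ r ∈ Finset.range m, PowerSeries.coeff r (s * t) • H r =
      ∑ p ∈ Finset.range m, ∑ q ∈ Finset.range m, if p + q = r then
        (PowerSeries.coeff p s * PowerSeries.coeff q t) • H (p + q) else 0 := by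
    intro r hr
    rw [Finset.mem_range] at hr
    rw [PowerSeries.coeff_mul, Finset.sum_smul, ← Finset.sum_product', ← Finset.sum_filter]
    refine Finset.sum_congr ?_ fun x hx => ?_
    · ext x
      simp only [Finset.HasAntidiagonal.mem_antidiagonal, Finset.mem_filter, Finset.mem_product,
        Finset.mem_range]
      omega
    · rw [(Finset.mem_filter.mp hx).2]
  rw [Finset.sum_congr rfl h, Finset.sum_comm]
  refine Finset.sum_congr rfl fun p _ => ?_
  rw [Finset.sum_comm]
  refine Finset.sum_congr rfl fun q _ => ?_
  rw [Finset.sum_ite_eq]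
  simp only [Finset.mem_range, smul_ite, smul_zero]

end TruncatedProduct

section Takiff

variable {S : Type*} [Fintype S] (P : GaudinParameters S)

/-- The linear form `∑ t_p ℓ_p` on families of power series `∑ t_p X ^ p` at the sites. -/
def GaudinParameters.levelForm : (S → PowerSeries ℂ) →ₗ[ℂ] ℂ :=
  ∑ α, ∑ p ∈ Finset.range (P.m α), P.ℓ α p • (PowerSeries.coeff p).comp (LinearMap.proj α)

theorem GaudinParameters.levelForm_apply (t : S → PowerSeries ℂ) :
    P.levelForm t = ∑ α, ∑ p ∈ Finset.range (P.m α), PowerSeries.coeff p (t α) * P.ℓ α p := by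
  simp [levelForm, mul_comm]

variable {A 𝔤 : Type*} [CommRing A] [Algebra ℂ A] [LieRing 𝔤] [LieAlgebra ℂ 𝔤]
variable {P} {V : PoissonVertexAlgebra A} (R : TakiffRealisation P V 𝔤)

namespace TakiffRealisation

/-- The component along `Y` of the field `∑ t_p J_p`. -/
def current (Y : 𝔤) : (S → PowerSeries ℂ) →ₗ[ℂ] A :=
  ∑ α, ∑ p ∈ Finset.range (P.m α),
    ((PowerSeries.coeff p).comp (LinearMap.proj α)).smulRight (comp Y (R.J α p))

theorem current_apply (Y : 𝔤) (t : S → PowerSeries ℂ) : R.current Y t =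
    ∑ α, ∑ p ∈ Finset.range (P.m α), PowerSeries.coeff p (t α) • comp Y (R.J α p) := by
  simp [current]

open Polynomial in
-- The condition `p + q < m` in the Takiff brackets is multiplication of series truncated at order
-- `m`. Since `current` and `levelForm` ignore higher coefficients, full power series can be used in
-- place of a quotient ring.
theorem bracket_current (Y Z : 𝔤) (s t : S → PowerSeries ℂ) :
    V.bracket (R.current Y s) (R.current Z t) = C (R.current ⁅Y, Z⁆ (s * t)) +
      C (algebraMap ℂ A (P.levelForm (s * t) * kappa 𝔤 Y Z)) * X := by
  classical
  have hb : ∀ α, ∀ p ∈ Finset.range (P.m α), ∀ β, ∀ q ∈ Finset.range (P.m β),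
      V.bracket (comp Y (R.J α p)) (comp Z (R.J β q)) =
        if α = β then (if p + q < P.m α then C (comp ⁅Y, Z⁆ (R.J α (p + q))) +
          C (algebraMap ℂ A (P.ℓ α (p + q) * kappa 𝔤 Y Z)) * X else 0) else 0 := by
    intro α p hp β q hq
    rw [Finset.mem_range] at hp hq
    split_ifs with h1 h2
    · subst h1
      exact R.bracket_same α p q hp hq h2 Y Z
    · subst h1
      exact R.bracket_same_zero α p q hp hq (not_lt.mp h2) Y Z
    · exact R.bracket_ne α β p q h1 hp hq Y Z
  have hL : V.bracket (R.current Y s) (R.current Z t) =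
      ∑ α, ∑ q ∈ Finset.range (P.m α), ∑ p ∈ Finset.range (P.m α),
        (PowerSeries.coeff p (s α) * PowerSeries.coeff q (t α)) • if p + q < P.m α then
          C (comp ⁅Y, Z⁆ (R.J α (p + q))) +
          C (algebraMap ℂ A (P.ℓ α (p + q) * kappa 𝔤 Y Z)) * X else 0 := by
    rw [current_apply, current_apply]
    simp only [map_sum, map_smul, LinearMap.sum_apply, LinearMap.smul_apply, Finset.smul_sum]
    refine Finset.sum_congr rfl fun α _ => Finset.sum_congr rfl fun q hq => ?_
    rw [Finset.sum_eq_single α]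
    · refine Finset.sum_congr rfl fun p hp => ?_
      rw [hb α p hp α q hq, if_pos rfl, smul_smul, mul_comm]
    · intro β _ hβ
      refine Finset.sum_eq_zero fun p hp => ?_
      rw [hb β p hp α q hq, if_neg hβ, smul_zero, smul_zero]
    · simp
  rw [hL, Finset.sum_congr rfl fun α _ => Finset.sum_comm]
  have hs := fun α => sum_coeff_mul (P.m α) (s α) (t α) fun r =>
    (C (comp ⁅Y, Z⁆ (R.J α r)) + C (algebraMap ℂ A (P.ℓ α r * kappa 𝔤 Y Z)) * X : A[X])
  simp only [← hs]
  rw [current_apply, P.levelForm_apply]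
  simp only [Finset.sum_mul, map_sum, smul_add, Finset.sum_add_distrib, Pi.mul_apply]
  congr 1
  · simp only [← smul_C]
  · refine Finset.sum_congr rfl fun α _ => Finset.sum_congr rfl fun p _ => ?_
    simp only [Algebra.smul_def, Polynomial.algebraMap_apply, map_mul]
    ring

variable {n : Type*} [Fintype n] [DecidableEq n] {e : Module.Basis n ℂ 𝔤}

/-- The current algebra formed by a Takiff realisation. -/
def currentAlgebra (he : IsOrthonormal e) : CurrentAlgebra V (S → PowerSeries ℂ) n where
  J a := R.current (e a)
  ℓ := P.levelForm
  f a b c := kappa 𝔤 ⁅e a, e b⁆ (e c)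
  f_swap_left a b c := by
    rw [← lie_skew, map_neg, LinearMap.neg_apply]
  f_swap_right a b c := by
    rw [kappa_lie, kappa_lie, ← lie_skew, map_neg]
  bracket_J a b s t := by
    rw [bracket_current, he a b]
    congr 2
    · simp only [current_apply, he.comp_eq_sum ⁅e a, e b⁆, Finset.smul_sum]
      conv_rhs => rw [Finset.sum_comm]
      refine Finset.sum_congr rfl fun α _ => ?_
      conv_rhs => rw [Finset.sum_comm]
      exact Finset.sum_congr rfl fun p _ => Finset.sum_congr rfl fun c _ => smul_comm _ _ _
    · split_ifs <;> simp

theorem current_one (Y : 𝔤) : R.current Y 1 = comp Y R.constraint := by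
  rw [current_apply, constraint, comp, map_sum]
  refine Finset.sum_congr rfl fun α _ => ?_
  rw [Finset.sum_eq_single 0]
  · simp [comp]
  · intro p _ hp
    simp [PowerSeries.coeff_one, hp]
  · intro h
    exact absurd (Finset.mem_range.mpr (P.m_pos α)) h

theorem weakIdeal_currentAlgebra (he : IsOrthonormal e) :
    (R.currentAlgebra he).weakIdeal = R.weakIdeal := by
  apply le_antisymm
  · refine Ideal.span_le.mpr ?_
    rintro _ ⟨k, a, rfl⟩
    exact Ideal.subset_span ⟨k, e a, by rw [← current_one]; rfl⟩
  · refine Ideal.span_le.mpr ?_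
    rintro _ ⟨k, Y, rfl⟩
    have h : ∀ k, (V.D)^[k] (comp Y R.constraint) =
        ∑ a, kappa 𝔤 Y (e a) • (V.D)^[k] (comp (e a) R.constraint) := by
      intro k
      induction k with
      | zero => exact he.comp_eq_sum Y _
      | succ k ih => simp only [Function.iterate_succ_apply', ih, map_sum, Derivation.map_smul]
    rw [SetLike.mem_coe, h]
    refine sum_mem fun a _ => CurrentAlgebra.smul_mem_weakIdeal _ _ ?_
    rw [← current_one]
    exact Ideal.subset_span ⟨k, a, rfl⟩

end TakiffRealisation

end Takiff

/-! ### Local expansions of rational functions -/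

section Expansions

/-- A power series as a Laurent series. -/
abbrev toLaurent : PowerSeries ℂ →+* LaurentSeries ℂ := HahnSeries.ofPowerSeries ℤ ℂ

theorem expansionAt_X (c : OnePoint ℂ) : expansionAt c RatFunc.X = coordAt c := by
  rw [← RatFunc.algebraMap_X, expansionAt, RatFunc.liftRingHom_algebraMap]
  simp

theorem expansionAt_algebraMap_coe (ζ : ℂ) (p : Polynomial ℂ) :
    ∃ F : PowerSeries ℂ, expansionAt ζ (algebraMap _ _ p) = toLaurent F ∧
      PowerSeries.constantCoeff F = p.eval ζ := by
  refine ⟨p.eval₂ PowerSeries.C (PowerSeries.C ζ + PowerSeries.X), ?_, ?_⟩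
  · rw [expansionAt, RatFunc.liftRingHom_algebraMap, Polynomial.hom_eval₂]
    simp only [Polynomial.coe_eval₂RingHom]
    congr 1
    · ext r
      simp
    · simp [coordAt]
  · rw [Polynomial.hom_eval₂]
    simp [Polynomial.eval₂_eq_eval_map]

/-- A rational function without poles on the Riemann sphere is constant. -/
theorem exists_eq_C_of_regular (g : RatFunc ℂ)
    (hg : ∀ c, ∃ F : PowerSeries ℂ, expansionAt c g = toLaurent F) : ∃ k, g = RatFunc.C k := by
  -- A root of the denominator would, by regularity there, also be a root of the numerator, against
  -- coprimality.
  have hden : g.denom = 1 := by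
    refine Polynomial.eq_one_of_monic_natDegree_zero (RatFunc.monic_denom g) ?_
    by_contra hdeg
    obtain ⟨ζ, hζ⟩ := IsAlgClosed.exists_root g.denom fun h => hdeg
      (Polynomial.natDegree_eq_zero_iff_degree_le_zero.mpr h.le)
    obtain ⟨F, hF⟩ := hg ζ
    obtain ⟨N, hN, hN0⟩ := expansionAt_algebraMap_coe ζ g.num
    obtain ⟨D, hD, hD0⟩ := expansionAt_algebraMap_coe ζ g.denom
    have h : toLaurent (F * D) = toLaurent N := by
      rw [map_mul, ← hF, ← hD, ← hN, ← map_mul]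
      congr 1
      exact ((div_eq_iff ((map_ne_zero_iff _ (RatFunc.algebraMap_injective ℂ)).mpr
        g.denom_ne_zero)).mp g.num_div_denom).symm
    have h0 := congrArg PowerSeries.constantCoeff (HahnSeries.ofPowerSeries_injective h)
    rw [map_mul, hD0, hN0, hζ.eq_zero, mul_zero] at h0
    obtain ⟨a, b, hab⟩ := RatFunc.isCoprime_num_denom g
    have := congrArg (Polynomial.eval ζ) hab
    simp [hζ.eq_zero, ← h0] at this
  have hnum : g = algebraMap _ _ g.num := by
    conv_lhs => rw [← RatFunc.num_div_denom g, hden, map_one, div_one]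
  obtain ⟨F, hF⟩ := hg OnePoint.infty
  have hdeg : g.num.natDegree = 0 := by
    rw [← Nat.le_zero, Polynomial.natDegree_le_iff_coeff_eq_zero]
    intro N hN
    -- For a polynomial, the coefficient of `z ^ N` is that of `u ^ (-N)` in the expansion at
    -- infinity, which regularity kills for `N > 0`.
    have h1 : (expansionAt OnePoint.infty g).coeff (-(N : ℤ)) = g.num.coeff N := by
      rw [hnum, expansionAt, RatFunc.liftRingHom_algebraMap, ← hnum, Polynomial.coe_eval₂RingHom,
        Polynomial.eval₂_eq_sum, Polynomial.sum_def, HahnSeries.coeff_sum]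
      have : ∀ k, (HahnSeries.C (g.num.coeff k) * coordAt OnePoint.infty ^ k : LaurentSeries ℂ) =
          HahnSeries.single (-(k : ℤ)) (g.num.coeff k) := by
        intro k
        change HahnSeries.C _ * (HahnSeries.single (-1 : ℤ) (1 : ℂ)) ^ k = _
        rw [HahnSeries.single_pow, HahnSeries.C_apply, HahnSeries.single_mul_single]
        simp
      simp only [this, HahnSeries.coeff_single]
      simpa using fun h => h.symm
    rw [← h1, hF, PowerSeries.coeff_coe, if_pos (by omega)]
  rw [Polynomial.natDegree_eq_zero] at hdeg
  obtain ⟨k, hk⟩ := hdeg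
  exact ⟨k, by rw [hnum, ← hk, RatFunc.algebraMap_C]⟩

/-- A power series divides every power series of larger order. -/
theorem dvd_of_coeff {U F : PowerSeries ℂ} (k : ℕ) (hk : PowerSeries.coeff k U ≠ 0)
    (hU : ∀ j < k, PowerSeries.coeff j U = 0) (hF : ∀ j < k, PowerSeries.coeff j F = 0) :
    U ∣ F := by
  obtain ⟨U', rfl⟩ := PowerSeries.X_pow_dvd_iff.mpr hU
  have h0 : PowerSeries.constantCoeff U' ≠ 0 := by
    rwa [PowerSeries.coeff_X_pow_mul', if_pos le_rfl, Nat.sub_self,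
      PowerSeries.coeff_zero_eq_constantCoeff_apply] at hk
  refine (mul_dvd_mul_left _ ?_).trans (b := PowerSeries.X ^ k * 1)
    (by simpa using PowerSeries.X_pow_dvd_iff.mpr hF)
  exact ⟨U'⁻¹, (PowerSeries.mul_inv_cancel _ h0).symm⟩

/-- The factor `s` holds the common power of the local parameter, so one divisibility criterion
serves regular points, sites and infinity. -/
theorem expansionAt_div_of_dvd {c : OnePoint ℂ} {f g : RatFunc ℂ} {s : LaurentSeries ℂ}
    {F U : PowerSeries ℂ} (hf : expansionAt c f = s * toLaurent F)
    (hg : expansionAt c g = s * toLaurent U) (hg0 : g ≠ 0) (h : U ∣ F) :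
    ∃ Q : PowerSeries ℂ, expansionAt c (f / g) = toLaurent Q := by
  obtain ⟨Q, rfl⟩ := h
  refine ⟨Q, ?_⟩
  have : expansionAt c g ≠ 0 := (map_ne_zero _).mpr hg0
  rw [map_div₀, div_eq_iff this, hf, hg, map_mul]
  ring

theorem order_dichotomy {x : LaurentSeries ℂ} (hx : x ≠ 0) (hneg : ∀ n < 0, x.coeff n = 0)
    (h1 : x.order ≤ 1) : (x.coeff 0 ≠ 0 ∧ ¬ 0 < x.order) ∨
      (x.coeff 0 = 0 ∧ x.coeff 1 ≠ 0 ∧ 0 < x.order) := by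
  have hne : x.coeff x.order ≠ 0 := fun h => hx (HahnSeries.coeff_order_eq_zero.mp h)
  have h0 : 0 ≤ x.order := by
    by_contra h
    exact hne (hneg _ (not_le.mp h))
  rcases h0.eq_or_lt with h | h
  · rw [← h] at hne
    exact Or.inl ⟨hne, h.symm ▸ lt_irrefl _⟩
  · have h2 : x.order = 1 := by omega
    exact Or.inr ⟨HahnSeries.coeff_eq_zero_of_lt_order h, h2 ▸ hne, h⟩

end Expansions

/-! ### Expansions of the poles and uniqueness of partial fractions. -/

namespace GaudinParameters

variable {S : Type*} (P : GaudinParameters S)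

/-- The expansion of a simple pole at infinity, in the parameter `X = 1 / z` and divided by it. -/
def poleSeriesInfty (α : S) : PowerSeries ℂ := PowerSeries.mk fun n => P.z α ^ n

/-- The expansion of a simple pole at a regular point. -/
def poleSeries (ζ : ℂ) (α : S) : PowerSeries ℂ :=
  (PowerSeries.C (ζ - P.z α) + PowerSeries.X)⁻¹

theorem expansionAt_pole (c : OnePoint ℂ) (α : S) (p : ℕ) : expansionAt c (P.pole α p) =
    ((coordAt c - HahnSeries.C (P.z α))⁻¹) ^ (p + 1) := by
  rw [pole, map_inv₀, map_pow, map_sub, expansionAt_X, expansionAt_C, inv_pow]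

theorem poleSeries_mul {ζ : ℂ} {α : S} (h : P.z α ≠ ζ) :
    P.poleSeries ζ α * (PowerSeries.C (ζ - P.z α) + PowerSeries.X) = 1 :=
  PowerSeries.inv_mul_cancel _ (by simpa [sub_eq_zero] using h.symm)

theorem poleSeriesInfty_mul (α : S) :
    P.poleSeriesInfty α * (1 - PowerSeries.C (P.z α) * PowerSeries.X) = 1 := by
  ext n
  rw [mul_sub, mul_one, ← mul_assoc]
  rcases n with _ | n
  · simp [poleSeriesInfty]
  · rw [map_sub, PowerSeries.coeff_succ_mul_X, mul_comm, PowerSeries.coeff_C_mul,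
      PowerSeries.coeff_one]
    simp [poleSeriesInfty, pow_succ']

theorem expansionAt_coe_pole {ζ : ℂ} {α : S} (h : P.z α ≠ ζ) (p : ℕ) :
    expansionAt ζ (P.pole α p) = toLaurent (P.poleSeries ζ α ^ (p + 1)) := by
  have h1 : coordAt ζ - HahnSeries.C (P.z α) =
      toLaurent (PowerSeries.C (ζ - P.z α) + PowerSeries.X) := by
    change HahnSeries.C ζ + HahnSeries.single 1 1 - _ = _
    simp
    ring
  rw [expansionAt_pole, map_pow, h1]
  congr 1
  refine inv_eq_of_mul_eq_one_left ?_
  rw [← map_mul, P.poleSeries_mul h, map_one]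

theorem expansionAt_site_pole (α : S) (p : ℕ) :
    expansionAt (P.z α) (P.pole α p) = HahnSeries.single (-((p : ℤ) + 1)) 1 := by
  rw [expansionAt_pole]
  change (HahnSeries.C (P.z α) + HahnSeries.single 1 1 - _)⁻¹ ^ (p + 1) = _
  rw [add_sub_cancel_left]
  have : (HahnSeries.single (1 : ℤ) (1 : ℂ))⁻¹ = HahnSeries.single (-1) 1 := by
    refine inv_eq_of_mul_eq_one_right ?_
    rw [HahnSeries.single_mul_single]
    simp
  rw [this, HahnSeries.single_pow]
  simp

theorem expansionAt_infty_pole (α : S) (p : ℕ) :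
    expansionAt OnePoint.infty (P.pole α p) =
      HahnSeries.single 1 1 * toLaurent (PowerSeries.X ^ p * P.poleSeriesInfty α ^ (p + 1)) := by
  have h1 : coordAt OnePoint.infty - HahnSeries.C (P.z α) = HahnSeries.single (-1) 1 *
      toLaurent (1 - PowerSeries.C (P.z α) * PowerSeries.X) := by
    change HahnSeries.single (-1) 1 - _ = _
    simp [mul_sub, HahnSeries.single_mul_single]
  have h2 : (coordAt OnePoint.infty - HahnSeries.C (P.z α))⁻¹ =
      toLaurent (PowerSeries.X * P.poleSeriesInfty α) := by
    refine inv_eq_of_mul_eq_one_right ?_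
    have h3 : (HahnSeries.single (-1 : ℤ) (1 : ℂ)) * HahnSeries.single 1 1 = 1 := by
      rw [HahnSeries.single_mul_single]
      simp
    have h4 := congrArg toLaurent (P.poleSeriesInfty_mul α)
    rw [map_mul, map_one] at h4
    rw [h1, map_mul, HahnSeries.ofPowerSeries_X]
    linear_combination (toLaurent (P.poleSeriesInfty α) *
      toLaurent (1 - PowerSeries.C (P.z α) * PowerSeries.X)) * h3 + h4
  rw [expansionAt_pole, h2, ← map_pow, ← HahnSeries.ofPowerSeries_X, ← map_mul]
  congr 1
  ring

variable [Fintype S]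

/-- The rational function with poles at the sites and given coefficients. -/
def rational (c : S → ℕ → ℂ) : RatFunc ℂ :=
  ∑ α, ∑ p ∈ Finset.range (P.m α), RatFunc.C (c α p) * P.pole α p

theorem twist_eq_rational : P.twist = P.rational P.ℓ := rfl

/-- Linear combinations of power series at the sites. -/
def combine (c : S → ℕ → ℂ) (f : S → ℕ → PowerSeries ℂ) : PowerSeries ℂ :=
  ∑ α, ∑ p ∈ Finset.range (P.m α), PowerSeries.C (c α p) * f α p

theorem coeff_combine (c : S → ℕ → ℂ) (f : S → ℕ → PowerSeries ℂ) (k : ℕ) :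
    PowerSeries.coeff k (P.combine c f) =
      ∑ α, ∑ p ∈ Finset.range (P.m α), c α p * PowerSeries.coeff k (f α p) := by
  simp [combine]

theorem expansionAt_rational {x : OnePoint ℂ} {s : LaurentSeries ℂ} {f : S → ℕ → PowerSeries ℂ}
    (h : ∀ α, ∀ p < P.m α, expansionAt x (P.pole α p) = s * toLaurent (f α p))
    (c : S → ℕ → ℂ) : expansionAt x (P.rational c) = s * toLaurent (P.combine c f) := by
  simp only [rational, combine, map_sum, map_mul, Finset.mul_sum, expansionAt_C]
  refine Finset.sum_congr rfl fun α _ => Finset.sum_congr rfl fun p hp => ?_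
  rw [h α p (Finset.mem_range.mp hp), HahnSeries.ofPowerSeries_C]
  ring

/-- The expansions of all poles at a site have a common factor. -/
theorem exists_expansionAt_site (α : S) : ∃ f : S → ℕ → PowerSeries ℂ,
    (∀ β, ∀ p < P.m β, expansionAt (P.z α) (P.pole β p) =
      HahnSeries.single (-(P.m α : ℤ)) 1 * toLaurent (f β p)) ∧
    ∀ (c : S → ℕ → ℂ), ∀ p < P.m α,
      PowerSeries.coeff (P.m α - 1 - p) (P.combine c f) = c α p := by
  classical
  -- After multiplication by the `m α`-th power of the local parameter, the poles at `α` become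
  -- distinct monomials of degree below `m α`, while the other sites contribute only from degree `m
  -- α` on.
  refine ⟨fun β p => if β = α then PowerSeries.X ^ (P.m α - 1 - p) else
    PowerSeries.X ^ P.m α * P.poleSeries (P.z α) β ^ (p + 1), fun β p hp => ?_, fun c p hp => ?_⟩
  · dsimp only
    split_ifs with h
    · subst h
      rw [expansionAt_site_pole, HahnSeries.ofPowerSeries_X_pow, HahnSeries.single_mul_single,
        mul_one, show -((p : ℤ) + 1) = -(P.m β : ℤ) + ((P.m β - 1 - p : ℕ) : ℤ) by omega]
    · rw [P.expansionAt_coe_pole (fun h' => h (P.z_injective h')), map_mul,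
        HahnSeries.ofPowerSeries_X_pow, ← mul_assoc, HahnSeries.single_mul_single]
      simp
  · rw [coeff_combine, Finset.sum_eq_single α, Finset.sum_eq_single p]
    · simp
    · intro q hq hqp
      rw [Finset.mem_range] at hq
      rw [if_pos rfl, PowerSeries.coeff_X_pow, if_neg (by omega), mul_zero]
    · intro h
      exact absurd (Finset.mem_range.mpr hp) h
    · intro β _ hβ
      refine Finset.sum_eq_zero fun q _ => ?_
      rw [if_neg hβ, PowerSeries.coeff_X_pow_mul', if_neg (by omega), mul_zero]
    · simp

theorem coeff_eq_zero_of_rational_eq_zero {c : S → ℕ → ℂ} (h : P.rational c = 0) (α : S) (p : ℕ)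
    (hp : p < P.m α) : c α p = 0 := by
  obtain ⟨f, hf, hc⟩ := P.exists_expansionAt_site α
  have h1 := P.expansionAt_rational hf c
  rw [h, map_zero] at h1
  have h2 : toLaurent (P.combine c f) = 0 :=
    (mul_eq_zero.mp h1.symm).resolve_left (by simp)
  have h3 : P.combine c f = 0 := HahnSeries.ofPowerSeries_injective (h2.trans (map_zero _).symm)
  rw [← hc c p hp, h3, map_zero]

theorem twist_ne_zero [Nonempty S] : P.twist ≠ 0 := fun h => by
  obtain ⟨α⟩ := ‹Nonempty S›
  exact P.ℓ_top α (P.coeff_eq_zero_of_rational_eq_zero h α _ (Nat.sub_lt (P.m_pos α) one_pos))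

end GaudinParameters

/-! ### The quadratic field dual to ℓ as a sum of charges. -/

namespace CurrentAlgebra

variable {A : Type*} [CommRing A] [Algebra ℂ A] {V : PoissonVertexAlgebra A}
  {T n : Type*} [CommRing T] [Algebra ℂ T] [Fintype n] [DecidableEq n]
  (K : CurrentAlgebra V T n)

/-- If an orthogonal family together with `1` spans the orthogonal complement of `1`, then the
quadratic field dual to `ℓ` is weakly the sum of the corresponding charges. -/
theorem IsOrthogonalFamily.sum_form_sub_mem {K : CurrentAlgebra V T n} {ι : Type*} [Fintype ι]
    {u : ι → T} {b : ι → ℂ} (hu : K.IsOrthogonalFamily u b) (v : ι → T)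
    (hspan : ∀ s, K.ℓ s = 0 → (∀ i, K.ℓ (s * u i) = 0) → ∃ k : ℂ, ∀ a, K.J a s = k • K.J a 1)
    {w : T} (hw : K.ℓ w = 1) {κ : Type*} [Fintype κ] (e e' : κ → T)
    (hdual : ∀ a t, K.J a t = ∑ j, K.ℓ (t * e' j) • K.J a (e j)) :
    (1 / 2 : ℂ) • ∑ j, K.form (e j) (e' j) - ∑ i, K.charge (u i) (v i) (b i) ∈ K.weakIdeal := by
  classical
  have hJ : ∀ j, ∃ k : ℂ, ∀ a, K.J a (e' j) = k • K.J a 1 + K.ℓ (e' j) • K.J a w +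
      ∑ i, (b i * (K.ℓ (u i * e' j) - K.ℓ (e' j) * K.ℓ (w * u i))) • K.J a (u i) := by
    intro j
    -- Subtracting a multiple of `w` makes the element orthogonal to `1`; subtracting next its
    -- projections on the `u i` leaves an element to which `hspan` applies.
    set h := e' j - K.ℓ (e' j) • w with hh
    obtain ⟨k, hk⟩ := hspan (h - ∑ i, (b i * K.ℓ (h * u i)) • u i)
      (by simp [hh, hw, hu.ℓ_eq_zero]) (fun l => by
        rw [sub_mul, Finset.sum_mul, map_sub, map_sum, Finset.sum_eq_single l]
        · rw [smul_mul_assoc, map_smul, smul_eq_mul]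
          linear_combination -(K.ℓ (h * u l)) * hu.norm l
        · intro i _ hi
          rw [smul_mul_assoc, map_smul, hu.orthogonal i l hi, smul_zero]
        · simp)
    refine ⟨k, fun a => ?_⟩
    have hc : ∀ i, K.ℓ (h * u i) = K.ℓ (u i * e' j) - K.ℓ (e' j) * K.ℓ (w * u i) := fun i => by
      rw [hh, sub_mul, map_sub, smul_mul_assoc, map_smul, smul_eq_mul, mul_comm (e' j)]
    have hka := hk a
    simp only [hc, map_sub, map_sum, map_smul] at hka
    rw [hh, map_sub, map_smul] at hka
    rw [← hka]
    abel
  choose k hk using hJ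
  -- Multiplying the expansion of `J a (e' j)` by `J a (e j)` and summing, duality turns the
  -- coefficients `ℓ (e' j)` into `J a 1` and `ℓ (u i * e' j)` into `J a (u i)`. Apart from the
  -- squares of the `J a (u i)`, everything acquires the factor `J a 1`.
  have hpoint : ∀ a, ∑ j, K.J a (e j) * K.J a (e' j) = K.J a 1 * (∑ j, k j • K.J a (e j) +
      K.J a w - ∑ i, (b i * K.ℓ (w * u i)) • K.J a (u i)) +
      ∑ i, b i • (K.J a (u i) * K.J a (u i)) := by
    intro a
    have h1 : ∑ j, K.ℓ (e' j) • K.J a (e j) = K.J a 1 := by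
      rw [hdual a 1]; simp only [one_mul]
    have h2 : ∀ i, ∑ j, (b i * (K.ℓ (u i * e' j) - K.ℓ (e' j) * K.ℓ (w * u i))) •
        (K.J a (e j) * K.J a (u i)) = b i • (K.J a (u i) * K.J a (u i)) -
          (b i * K.ℓ (w * u i)) • (K.J a 1 * K.J a (u i)) := by
      intro i
      nth_rewrite 2 [hdual a (u i)]
      rw [← h1, Finset.sum_mul, Finset.sum_mul, Finset.smul_sum, Finset.smul_sum,
        ← Finset.sum_sub_distrib]
      refine Finset.sum_congr rfl fun j _ => ?_
      simp only [Algebra.smul_def, map_mul, map_sub]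
      ring
    have h3 : ∀ j, K.J a (e j) * K.J a (e' j) = k j • (K.J a 1 * K.J a (e j)) +
        (K.ℓ (e' j) • K.J a (e j)) * K.J a w +
        ∑ i, (b i * (K.ℓ (u i * e' j) - K.ℓ (e' j) * K.ℓ (w * u i))) •
          (K.J a (e j) * K.J a (u i)) := by
      intro j
      rw [hk j a, mul_add, mul_add, Finset.mul_sum]
      simp only [mul_smul_comm, smul_mul_assoc, mul_comm (K.J a 1)]
    rw [Finset.sum_congr rfl fun j _ => h3 j, Finset.sum_add_distrib, Finset.sum_add_distrib,
      ← Finset.sum_mul, h1, Finset.sum_comm, Finset.sum_congr rfl fun i _ => h2 i,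
      Finset.sum_sub_distrib]
    simp only [mul_add, mul_sub, Finset.mul_sum, mul_smul_comm]
    ring
  have hsum : (1 / 2 : ℂ) • ∑ j, K.form (e j) (e' j) - ∑ i, K.charge (u i) (v i) (b i) =
      (1 / 2 : ℂ) • ∑ a, K.J a 1 * (∑ j, k j • K.J a (e j) +
        K.J a w - ∑ i, (b i * K.ℓ (w * u i)) • K.J a (u i)) - ∑ i, K.form 1 (v i) := by
    simp only [form, charge]
    rw [Finset.sum_comm, Finset.sum_congr rfl fun a _ => hpoint a, Finset.sum_add_distrib,
      Finset.sum_add_distrib, smul_add]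
    have : ∑ i, (b i / 2) • ∑ a, K.J a (u i) * K.J a (u i) =
        (1 / 2 : ℂ) • ∑ a, ∑ i, b i • (K.J a (u i) * K.J a (u i)) := by
      rw [Finset.sum_comm, Finset.smul_sum]
      refine Finset.sum_congr rfl fun i _ => ?_
      rw [← Finset.smul_sum, smul_smul]
      congr 1
      ring
    rw [this]
    abel
  rw [hsum]
  exact sub_mem (K.smul_mem_weakIdeal _ (sum_mem fun a _ =>
    K.weakIdeal.mul_mem_right _ (K.J_one_mem a))) (sum_mem fun i _ => K.form_one_mem _)

end CurrentAlgebra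

/-! ### Local data at the zeros of the twist function -/

section Laurent

theorem coeff_single_mul_toLaurent (a : ℤ) (F : PowerSeries ℂ) (k : ℕ) {n : ℤ} (h : n = a + k) :
    (HahnSeries.single a (1 : ℂ) * toLaurent F).coeff n = PowerSeries.coeff k F := by
  rw [h, add_comm, HahnSeries.coeff_single_mul_add, one_mul,
    LaurentSeries.coeff_coe_powerSeries]

theorem coeff_single_mul_toLaurent_of_lt (a : ℤ) (F : PowerSeries ℂ) {n : ℤ} (h : n < a) :
    (HahnSeries.single a (1 : ℂ) * toLaurent F).coeff n = 0 := by
  rw [HahnSeries.coeff_single_mul, one_mul, PowerSeries.coeff_coe, if_pos (by omega)]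

theorem exists_inv_toLaurent {H : PowerSeries ℂ} (k : ℕ)
    (hlt : ∀ j < k, PowerSeries.coeff j H = 0) (hk : PowerSeries.coeff k H ≠ 0) :
    ∃ Q : PowerSeries ℂ, (toLaurent H)⁻¹ = HahnSeries.single (-(k : ℤ)) 1 * toLaurent Q ∧
      PowerSeries.constantCoeff Q = (PowerSeries.coeff k H)⁻¹ := by
  obtain ⟨U, rfl⟩ := PowerSeries.X_pow_dvd_iff.mpr hlt
  rw [PowerSeries.coeff_X_pow_mul', if_pos le_rfl, Nat.sub_self,
    PowerSeries.coeff_zero_eq_constantCoeff_apply] at hk ⊢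
  refine ⟨U⁻¹, inv_eq_of_mul_eq_one_right ?_, PowerSeries.constantCoeff_inv _⟩
  rw [map_mul, HahnSeries.ofPowerSeries_X_pow, mul_mul_mul_comm, HahnSeries.single_mul_single,
    ← map_mul, PowerSeries.mul_inv_cancel _ hk, map_one]
  simp

end Laurent

namespace GaudinParameters

variable {S : Type*} (P : GaudinParameters S)

/-- The element of the current algebra attached to a point of the Riemann sphere: the family of
expansions of `1 / (ζ - z)` at the sites for a finite point `ζ`, and of `z` for infinity. -/
def kernel (c : OnePoint ℂ) : S → PowerSeries ℂ :=
  c.elim (fun α => PowerSeries.C (P.z α) + PowerSeries.X)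
    (fun ζ α => PowerSeries.mk fun p => (ζ - P.z α)⁻¹ ^ (p + 1))

/-- At the site `α` the coordinate z is `z α + X`, so the second factor is ζ - z. -/
theorem kernel_coe_mul {ζ : ℂ} (h : ∀ α, P.z α ≠ ζ) :
    P.kernel ζ * (fun α => PowerSeries.C (ζ - P.z α) - PowerSeries.X) = 1 := by
  funext α
  have h0 : ζ - P.z α ≠ 0 := sub_ne_zero.mpr (h α).symm
  change (PowerSeries.mk fun p => (ζ - P.z α)⁻¹ ^ (p + 1)) * _ = 1
  ext n
  rw [mul_sub, map_sub, mul_comm _ (PowerSeries.C _), PowerSeries.coeff_C_mul]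
  rcases n with _ | n
  · simp [h0]
  · rw [PowerSeries.coeff_succ_mul_X, PowerSeries.coeff_mk, PowerSeries.coeff_mk,
      PowerSeries.coeff_one, if_neg (by omega), pow_succ' _ (n + 1), mul_inv_cancel_left₀ h0,
      sub_self]

/-- The geometric expansion of 1/(ζ - z) around z_α has the values at ζ of the poles as its
coefficients. Pairing levels with the kernel therefore evaluates φ at ζ. -/
theorem coeff_zero_poleSeries (ζ : ℂ) (α : S) (p : ℕ) :
    PowerSeries.coeff 0 (P.poleSeries ζ α ^ (p + 1)) = PowerSeries.coeff p (P.kernel ζ α) := by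
  change _ = PowerSeries.coeff p (PowerSeries.mk fun p => (ζ - P.z α)⁻¹ ^ (p + 1))
  simp [poleSeries]

/-- The derivative in ζ of the previous identity: that of 1/(ζ - z) is -1/(ζ - z)². It identifies ℓ
of the squared kernel with -φ'(ζ). -/
theorem coeff_one_poleSeries {ζ : ℂ} {α : S} (h : P.z α ≠ ζ) (p : ℕ) :
    PowerSeries.coeff 1 (P.poleSeries ζ α ^ (p + 1)) =
      -PowerSeries.coeff p (P.kernel ζ α * P.kernel ζ α) := by
  have h0 : ζ - P.z α ≠ 0 := sub_ne_zero.mpr h.symm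
  have hc : PowerSeries.constantCoeff (P.poleSeries ζ α) = (ζ - P.z α)⁻¹ := by simp [poleSeries]
  have h1 : PowerSeries.coeff 1 (P.poleSeries ζ α) = -((ζ - P.z α)⁻¹ ^ 2) := by
    have := congrArg (PowerSeries.coeff 1) (P.poleSeries_mul h)
    rw [mul_add, map_add, mul_comm _ (PowerSeries.C _), PowerSeries.coeff_C_mul,
      show (1 : ℕ) = 0 + 1 from rfl, PowerSeries.coeff_succ_mul_X, PowerSeries.coeff_one,
      if_neg (by omega), PowerSeries.coeff_zero_eq_constantCoeff_apply, hc] at this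
    field_simp at this ⊢
    linear_combination this
  change _ = -PowerSeries.coeff p ((PowerSeries.mk fun p => (ζ - P.z α)⁻¹ ^ (p + 1)) *
    (PowerSeries.mk fun p => (ζ - P.z α)⁻¹ ^ (p + 1)))
  rw [PowerSeries.coeff_one_pow, h1, hc, PowerSeries.coeff_mul,
    Finset.Nat.sum_antidiagonal_eq_sum_range_succ_mk, Nat.add_sub_cancel]
  have : ∀ k ∈ Finset.range p.succ, PowerSeries.coeff k (PowerSeries.mk fun p =>
      (ζ - P.z α)⁻¹ ^ (p + 1)) * PowerSeries.coeff (p - k) (PowerSeries.mk fun p =>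
      (ζ - P.z α)⁻¹ ^ (p + 1)) = (ζ - P.z α)⁻¹ ^ (p + 2) := by
    intro k hk
    rw [Finset.mem_range] at hk
    rw [PowerSeries.coeff_mk, PowerSeries.coeff_mk, ← pow_add]
    congr 1
    omega
  rw [Finset.sum_congr rfl this, Finset.sum_const, Finset.card_range, nsmul_eq_mul]
  generalize (ζ - P.z α)⁻¹ = y
  push_cast
  ring

/-- The expansions of the poles at infinity. -/
def inftySeries (α : S) (p : ℕ) : PowerSeries ℂ :=
  PowerSeries.X ^ p * P.poleSeriesInfty α ^ (p + 1)

/-- With u = 1/z one has 1/(z - w) = u (1 + w u + w² u² + ...). Once the factor u is removed, orders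
0, 1, 2 correspond to the germs 1, w, w², and the germ of w is the kernel at infinity. -/
theorem coeff_zero_inftySeries (α : S) (p : ℕ) :
    PowerSeries.coeff 0 (P.inftySeries α p) = PowerSeries.coeff p (1 : PowerSeries ℂ) := by
  rcases p with _ | p
  · simp [inftySeries, poleSeriesInfty]
  · simp [inftySeries, PowerSeries.coeff_one]

theorem coeff_one_inftySeries (α : S) (p : ℕ) : PowerSeries.coeff 1 (P.inftySeries α p) =
    PowerSeries.coeff p (P.kernel OnePoint.infty α) := by
  change _ = PowerSeries.coeff p (PowerSeries.C (P.z α) + PowerSeries.X)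
  rcases p with _ | _ | p
  · simp [inftySeries, poleSeriesInfty]
  · simp [inftySeries, poleSeriesInfty]
  · rw [inftySeries, PowerSeries.coeff_X_pow_mul', if_neg (by omega)]
    simp [PowerSeries.coeff_X]

theorem coeff_two_inftySeries (α : S) (p : ℕ) : PowerSeries.coeff 2 (P.inftySeries α p) =
    PowerSeries.coeff p (P.kernel OnePoint.infty α * P.kernel OnePoint.infty α) := by
  change _ = PowerSeries.coeff p ((PowerSeries.C (P.z α) + PowerSeries.X) *
    (PowerSeries.C (P.z α) + PowerSeries.X))
  have h : (PowerSeries.C (P.z α) + PowerSeries.X) * (PowerSeries.C (P.z α) + PowerSeries.X) =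
      PowerSeries.C (P.z α ^ 2) + PowerSeries.C (2 * P.z α) * PowerSeries.X ^ 1 +
        PowerSeries.X ^ 2 := by
    simp only [map_mul, map_pow, map_ofNat]
    ring
  rw [h, map_add, map_add, PowerSeries.coeff_C, PowerSeries.coeff_C_mul, PowerSeries.coeff_X_pow,
    PowerSeries.coeff_X_pow, inftySeries, PowerSeries.coeff_X_pow_mul']
  rcases p with _ | _ | _ | p
  · simp [poleSeriesInfty]
  · simp [PowerSeries.coeff_one_pow, poleSeriesInfty]
  · simp [poleSeriesInfty]
  · simp

/-- The coefficients of the linear form `t ↦ ℓ (s * t)`. -/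
def dual (s : S → PowerSeries ℂ) (α : S) (p : ℕ) : ℂ :=
  ∑ q ∈ Finset.range (P.m α), PowerSeries.coeff q (s α) *
    if q + p < P.m α then P.ℓ α (q + p) else 0

theorem dual_one (α : S) (p : ℕ) (hp : p < P.m α) : P.dual 1 α p = P.ℓ α p := by
  rw [dual, Finset.sum_eq_single 0]
  · simp [hp]
  · intro q _ hq
    simp [PowerSeries.coeff_one, hq]
  · intro h
    exact absurd (Finset.mem_range.mpr (P.m_pos α)) h

variable [Fintype S]

theorem levelForm_mul (s t : S → PowerSeries ℂ) : P.levelForm (s * t) =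
    ∑ α, ∑ p ∈ Finset.range (P.m α), P.dual s α p * PowerSeries.coeff p (t α) := by
  rw [levelForm_apply]
  refine Finset.sum_congr rfl fun α _ => ?_
  have := sum_coeff_mul (P.m α) (s α) (t α) (P.ℓ α)
  simp only [smul_eq_mul] at this
  rw [Pi.mul_apply, this, Finset.sum_comm]
  refine Finset.sum_congr rfl fun p _ => ?_
  rw [dual, Finset.sum_mul]
  exact Finset.sum_congr rfl fun q _ => by ring

/-- Taylor coefficients of the rational function built on `dual s` become pairings with `s`, so
orthogonality conditions turn into vanishing conditions. -/
theorem coeff_combine_dual {f : S → ℕ → PowerSeries ℂ} {k : ℕ} {t : S → PowerSeries ℂ}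
    (h : ∀ α p, PowerSeries.coeff k (f α p) = PowerSeries.coeff p (t α)) (s : S → PowerSeries ℂ) :
    PowerSeries.coeff k (P.combine (P.dual s) f) = P.levelForm (s * t) := by
  simp only [coeff_combine, h, levelForm_mul]

theorem coeff_combine_ℓ {f : S → ℕ → PowerSeries ℂ} {k : ℕ} {t : S → PowerSeries ℂ}
    (h : ∀ α p, PowerSeries.coeff k (f α p) = PowerSeries.coeff p (t α)) :
    PowerSeries.coeff k (P.combine P.ℓ f) = P.levelForm t := by
  simp only [coeff_combine, h, levelForm_apply, mul_comm]

/-- The element of the current algebra dual to `X ^ p` at a site. -/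
def dualElement [DecidableEq S] (α : S) (p : ℕ) : S → PowerSeries ℂ :=
  Pi.single α (PowerSeries.mk fun r => P.k α (p + r))

/-- This is the linear system `sum_k_mul_ℓ` defining the numbers `k`, read as duality for the form
`ℓ (s * t)`. -/
theorem levelForm_mul_dualElement [DecidableEq S] (t : S → PowerSeries ℂ) (α : S) (p : ℕ)
    (hp : p < P.m α) : P.levelForm (t * P.dualElement α p) = PowerSeries.coeff p (t α) := by
  rw [mul_comm, levelForm_mul, Finset.sum_eq_single α]
  · have h : ∀ r ∈ Finset.range (P.m α), P.dual (P.dualElement α p) α r =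
        if p = r then 1 else 0 := by
      intro r hr
      rw [Finset.mem_range] at hr
      rw [← P.sum_k_mul_ℓ α p r hp hr, dual]
      simp only [dualElement, Pi.single_eq_same, PowerSeries.coeff_mk, mul_ite, mul_zero]
      rw [← Finset.sum_filter]
      refine Finset.sum_congr ?_ fun q _ => by rw [add_comm p]
      ext q
      simp only [Finset.mem_filter, Finset.mem_range]
      omega
    rw [Finset.sum_congr rfl fun r hr => by rw [h r hr]]
    simp [hp]
  · intro β _ hβ
    simp [dual, dualElement, hβ]
  · simp

theorem exists_levelForm_eq_one [Nonempty S] : ∃ w, P.levelForm w = 1 := by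
  classical
  obtain ⟨α⟩ := ‹Nonempty S›
  refine ⟨1 * P.dualElement α 0, ?_⟩
  rw [P.levelForm_mul_dualElement _ α 0 (P.m_pos α)]
  simp

theorem levelForm_one (hfirst : ∑ α, P.ℓ α 0 = 0) : P.levelForm 1 = 0 := by
  rw [levelForm_apply, ← hfirst]
  refine Finset.sum_congr rfl fun α _ => ?_
  rw [Finset.sum_eq_single 0]
  · simp
  · intro q _ hq
    simp [PowerSeries.coeff_one, hq]
  · intro h
    exact absurd (Finset.mem_range.mpr (P.m_pos α)) h

/-! #### The twist function in local coordinates -/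

theorem formAt_ne_zero (c : OnePoint ℂ) [Nonempty S] : formAt c P.twist ≠ 0 := by
  refine mul_ne_zero ?_ ((map_ne_zero _).mpr P.twist_ne_zero)
  cases c with
  | infty => exact neg_ne_zero.mpr (by simp)
  | coe ζ => exact one_ne_zero

theorem order_site_lt (α : S) : (formAt (P.z α) P.twist).order < 0 := by
  obtain ⟨f, hf, hc⟩ := P.exists_expansionAt_site α
  have h1 := P.expansionAt_rational hf P.ℓ
  have h2 : (formAt (P.z α) P.twist).coeff (-(P.m α : ℤ)) = P.ℓ α (P.m α - 1) := by
    rw [formAt, twist_eq_rational, h1, ← hc P.ℓ _ (Nat.sub_lt (P.m_pos α) one_pos)]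
    change (1 * _ : LaurentSeries ℂ).coeff _ = _
    rw [one_mul]
    exact coeff_single_mul_toLaurent _ _ _ (by have := P.m_pos α; omega)
  have h3 := HahnSeries.order_le_of_coeff_ne_zero (h2.symm ▸ P.ℓ_top α)
  have := P.m_pos α
  omega

theorem ne_of_order_pos {ζ : ℂ} (h : 0 < (formAt ζ P.twist).order) (α : S) : P.z α ≠ ζ := by
  rintro rfl
  exact absurd (P.order_site_lt α) (not_lt.mpr h.le)

theorem expansionAt_rational_coe {ζ : ℂ} (h : ∀ α, P.z α ≠ ζ) (c : S → ℕ → ℂ) :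
    expansionAt ζ (P.rational c) =
      1 * toLaurent (P.combine c fun α p => P.poleSeries ζ α ^ (p + 1)) :=
  P.expansionAt_rational (fun α p _ => by rw [P.expansionAt_coe_pole (h α), one_mul]) c

theorem expansionAt_rational_infty (c : S → ℕ → ℂ) : expansionAt OnePoint.infty (P.rational c) =
    HahnSeries.single 1 1 * toLaurent (P.combine c P.inftySeries) :=
  P.expansionAt_rational (fun α p _ => P.expansionAt_infty_pole α p) c

theorem formAt_coe {ζ : ℂ} (h : ∀ α, P.z α ≠ ζ) : formAt ζ P.twist =
    HahnSeries.single 0 1 * toLaurent (P.combine P.ℓ fun α p => P.poleSeries ζ α ^ (p + 1)) := by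
  rw [formAt, twist_eq_rational, P.expansionAt_rational_coe h]
  change 1 * _ = _
  simp

theorem formAt_infty : formAt OnePoint.infty P.twist =
    -(HahnSeries.single (-1) 1 * toLaurent (P.combine P.ℓ P.inftySeries)) := by
  rw [formAt, twist_eq_rational, P.expansionAt_rational_infty]
  have hj : jacobianAt OnePoint.infty = -(HahnSeries.single (-2 : ℤ) (1 : ℂ)) := rfl
  have h : HahnSeries.single (-2 : ℤ) (1 : ℂ) * HahnSeries.single 1 1 =
      HahnSeries.single (-1) 1 := by
    rw [HahnSeries.single_mul_single]
    simp
  rw [hj, ← h]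
  ring

/-- At a finite regular point, either the twist function does not vanish, or it has a simple
zero. -/
theorem levelForm_kernel_coe [Nonempty S] {ζ : ℂ} (h : ∀ α, P.z α ≠ ζ)
    (hsimple : (formAt ζ P.twist).order ≤ 1) :
    (P.levelForm (P.kernel ζ) ≠ 0 ∧ ¬ 0 < (formAt ζ P.twist).order) ∨
      (P.levelForm (P.kernel ζ) = 0 ∧ P.levelForm (P.kernel ζ * P.kernel ζ) ≠ 0 ∧
        0 < (formAt ζ P.twist).order) := by
  have hd := order_dichotomy (P.formAt_ne_zero ζ) (fun n hn => by
    rw [P.formAt_coe h, coeff_single_mul_toLaurent_of_lt _ _ hn]) hsimple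
  have h0 : (formAt ζ P.twist).coeff 0 = P.levelForm (P.kernel ζ) := by
    rw [P.formAt_coe h, coeff_single_mul_toLaurent 0 _ 0 (by simp)]
    exact P.coeff_combine_ℓ fun α p => P.coeff_zero_poleSeries ζ α p
  have h1 : (formAt ζ P.twist).coeff 1 = -P.levelForm (P.kernel ζ * P.kernel ζ) := by
    rw [P.formAt_coe h, coeff_single_mul_toLaurent 0 _ 1 (by simp), ← map_neg]
    refine P.coeff_combine_ℓ fun α p => ?_
    rw [P.coeff_one_poleSeries (h α)]
    simp
  rwa [h0, h1, neg_ne_zero] at hd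

/-- At infinity, either the form defined by the twist function does not vanish, or it has a simple
zero. -/
theorem levelForm_kernel_infty [Nonempty S] (hfirst : ∑ α, P.ℓ α 0 = 0)
    (hsimple : (formAt OnePoint.infty P.twist).order ≤ 1) :
    (P.levelForm (P.kernel OnePoint.infty) ≠ 0 ∧ ¬ 0 < (formAt OnePoint.infty P.twist).order) ∨
      (P.levelForm (P.kernel OnePoint.infty) = 0 ∧
        P.levelForm (P.kernel OnePoint.infty * P.kernel OnePoint.infty) ≠ 0 ∧
        0 < (formAt OnePoint.infty P.twist).order) := by
  have hco : ∀ (n : ℤ) (k : ℕ), n = -1 + k → (formAt OnePoint.infty P.twist).coeff n =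
      -PowerSeries.coeff k (P.combine P.ℓ P.inftySeries) := fun n k hk => by
    rw [P.formAt_infty, HahnSeries.coeff_neg, coeff_single_mul_toLaurent _ _ k hk]
  have hd := order_dichotomy (P.formAt_ne_zero OnePoint.infty) (fun n hn => by
    -- The only possible polar term at infinity is a simple pole, and its coefficient is minus the
    -- sum of the levels ℓ_0, zero by the first-class condition.
    rcases (show n = -1 ∨ n < -1 by omega) with rfl | hn
    · rw [hco (-1) 0 (by simp), P.coeff_combine_ℓ (t := 1) P.coeff_zero_inftySeries,
        P.levelForm_one hfirst, neg_zero]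
    · rw [P.formAt_infty, HahnSeries.coeff_neg, coeff_single_mul_toLaurent_of_lt _ _ hn, neg_zero])
    hsimple
  rwa [hco 0 1 (by simp), P.coeff_combine_ℓ P.coeff_one_inftySeries, hco 1 2 (by simp),
    P.coeff_combine_ℓ (t := P.kernel OnePoint.infty * P.kernel OnePoint.infty)
      P.coeff_two_inftySeries, neg_ne_zero, neg_ne_zero, neg_eq_zero] at hd

theorem levelForm_kernel [Nonempty S] (hfirst : ∑ α, P.ℓ α 0 = 0) {c : OnePoint ℂ}
    (hsimple : (formAt c P.twist).order ≤ 1) (hc : 0 < (formAt c P.twist).order) :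
    P.levelForm (P.kernel c) = 0 ∧ P.levelForm (P.kernel c * P.kernel c) ≠ 0 := by
  cases c with
  | infty =>
    rcases P.levelForm_kernel_infty hfirst hsimple with h | h
    · exact absurd hc h.2
    · exact ⟨h.1, h.2.1⟩
  | coe ζ =>
    rcases P.levelForm_kernel_coe (P.ne_of_order_pos hc) hsimple with h | h
    · exact absurd hc h.2
    · exact ⟨h.1, h.2.1⟩

/-- Partial fractions: (ζ - ξ)/((ξ - z)(ζ - z)) = 1/(ξ - z) - 1/(ζ - z), and z/(ζ - z) = -1 + ζ/(ζ -
z) when one point is infinity. -/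
theorem kernel_mul_kernel {c d : OnePoint ℂ} (hcd : c ≠ d)
    (hc : 0 < (formAt c P.twist).order) (hd : 0 < (formAt d P.twist).order) :
    ∃ x y z : ℂ, P.kernel c * P.kernel d = x • 1 + y • P.kernel c + z • P.kernel d := by
  have hinf : ∀ ζ : ℂ, 0 < (formAt ζ P.twist).order →
      P.kernel OnePoint.infty * P.kernel ζ = (-1 : ℂ) • 1 + ζ • P.kernel ζ := by
    intro ζ hζ
    have h := P.kernel_coe_mul (P.ne_of_order_pos hζ)
    have e : P.kernel OnePoint.infty + (fun α => PowerSeries.C (ζ - P.z α) - PowerSeries.X) =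
        algebraMap ℂ (S → PowerSeries ℂ) ζ := by
      funext α
      change PowerSeries.C (P.z α) + PowerSeries.X + (PowerSeries.C (ζ - P.z α) - PowerSeries.X) =
        PowerSeries.C ζ
      rw [map_sub]
      ring
    rw [Algebra.smul_def ζ, ← e, neg_smul, one_smul]
    linear_combination -h
  cases c with
  | infty =>
    cases d with
    | infty => exact absurd rfl hcd
    | coe ζ => exact ⟨-1, 0, ζ, by rw [hinf ζ hd, zero_smul, add_zero]⟩
  | coe ξ =>
    cases d with
    | infty => exact ⟨-1, ξ, 0, by rw [mul_comm, hinf ξ hc, zero_smul, add_zero]⟩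
    | coe ζ =>
      have hne : ζ - ξ ≠ 0 := sub_ne_zero.mpr fun h => hcd (by rw [h])
      have h1 := P.kernel_coe_mul (P.ne_of_order_pos hc)
      have h2 := P.kernel_coe_mul (P.ne_of_order_pos hd)
      have e : (fun α => PowerSeries.C (ζ - P.z α) - PowerSeries.X) -
          (fun α => PowerSeries.C (ξ - P.z α) - PowerSeries.X) =
          algebraMap ℂ (S → PowerSeries ℂ) (ζ - ξ) := by
        funext α
        change PowerSeries.C (ζ - P.z α) - PowerSeries.X -
          (PowerSeries.C (ξ - P.z α) - PowerSeries.X) = PowerSeries.C (ζ - ξ)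
        simp only [map_sub]
        ring
      refine ⟨0, (ζ - ξ)⁻¹, -(ζ - ξ)⁻¹, ?_⟩
      have e2 : (ζ - ξ) • (P.kernel ξ * P.kernel ζ) = P.kernel ξ - P.kernel ζ := by
        rw [Algebra.smul_def, ← e]
        linear_combination P.kernel ξ * h2 - P.kernel ζ * h1
      rw [zero_smul, zero_add, neg_smul, ← sub_eq_add_neg, ← smul_sub, ← e2, inv_smul_smul₀ hne]

/-- An element orthogonal to `1` and to the kernels at all zeros of the twist function is a
multiple of `1`, up to the kernel of the form `ℓ (s * t)`. -/
theorem exists_dual_eq [Nonempty S] (hfirst : ∑ α, P.ℓ α 0 = 0)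
    (hsimple : ∀ c, (formAt c P.twist).order ≤ 1) (s : S → PowerSeries ℂ)
    (h1 : P.levelForm s = 0)
    (hker : ∀ c, 0 < (formAt c P.twist).order → P.levelForm (s * P.kernel c) = 0) :
    ∃ k : ℂ, ∀ α, ∀ p < P.m α, P.dual s α p = k * P.ℓ α p := by
  -- The quotient has no poles: at a site the denominator has the full pole order `m α`, at a finite
  -- zero of φ the numerator vanishes by orthogonality to the kernel, and at infinity orthogonality
  -- to `1` and possibly to the kernel suffices.
  have hreg : ∀ c, ∃ F : PowerSeries ℂ,
      expansionAt c (P.rational (P.dual s) / P.twist) = toLaurent F := by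
    intro c
    cases c with
    | infty =>
      refine expansionAt_div_of_dvd (P.expansionAt_rational_infty _)
        (P.expansionAt_rational_infty _) P.twist_ne_zero ?_
      -- Since dz = -u⁻² du and one factor u has been extracted, the series here vanishes to one
      -- order more than the form φ dz: order 1 without a zero at infinity, order 2 at a simple
      -- zero.
      have hU0 : PowerSeries.coeff 0 (P.combine P.ℓ P.inftySeries) = 0 := by
        rw [P.coeff_combine_ℓ (t := 1) P.coeff_zero_inftySeries, P.levelForm_one hfirst]
      have hF0 : PowerSeries.coeff 0 (P.combine (P.dual s) P.inftySeries) = 0 := by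
        rw [P.coeff_combine_dual (t := 1) P.coeff_zero_inftySeries, mul_one, h1]
      have hU1 := P.coeff_combine_ℓ P.coeff_one_inftySeries
      have hU2 := P.coeff_combine_ℓ (t := P.kernel OnePoint.infty * P.kernel OnePoint.infty)
        P.coeff_two_inftySeries
      rcases P.levelForm_kernel_infty hfirst (hsimple _) with h | h
      · refine dvd_of_coeff 1 (hU1.symm ▸ h.1) ?_ ?_ <;> intro j hj <;> interval_cases j
        exacts [hU0, hF0]
      · refine dvd_of_coeff 2 (hU2.symm ▸ h.2.1) ?_ ?_ <;> intro j hj <;> interval_cases j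
        exacts [hU0, hU1.trans h.1, hF0,
          (P.coeff_combine_dual P.coeff_one_inftySeries s).trans (hker _ h.2.2)]
    | coe ζ =>
      by_cases hζ : ∀ α, P.z α ≠ ζ
      · refine expansionAt_div_of_dvd (P.expansionAt_rational_coe hζ _)
          (P.expansionAt_rational_coe hζ _) P.twist_ne_zero ?_
        have hU0 := P.coeff_combine_ℓ fun α p => P.coeff_zero_poleSeries ζ α p
        have hF0 := P.coeff_combine_dual (fun α p => P.coeff_zero_poleSeries ζ α p) s
        have hU1 := P.coeff_combine_ℓ (t := -(P.kernel ζ * P.kernel ζ)) fun α p => by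
          rw [P.coeff_one_poleSeries (hζ α) p, Pi.neg_apply, map_neg, Pi.mul_apply]
        rcases P.levelForm_kernel_coe hζ (hsimple _) with h | h
        · exact dvd_of_coeff 0 (hU0.symm ▸ h.1) (by simp) (by simp)
        · refine dvd_of_coeff 1 (hU1.symm ▸ ?_) ?_ ?_
          · rw [map_neg]
            exact neg_ne_zero.mpr h.2.1
          all_goals intro j hj; interval_cases j
          exacts [hU0.trans h.1, hF0.trans (hker _ h.2.2)]
      · push Not at hζ
        obtain ⟨α, rfl⟩ := hζ
        obtain ⟨f, hf, hc⟩ := P.exists_expansionAt_site α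
        refine expansionAt_div_of_dvd (P.expansionAt_rational hf _)
          (P.expansionAt_rational hf _) P.twist_ne_zero (dvd_of_coeff 0 ?_ (by simp) (by simp))
        have := hc P.ℓ _ (Nat.sub_lt (P.m_pos α) one_pos)
        rw [Nat.sub_self] at this
        rw [this]
        exact P.ℓ_top α
  obtain ⟨k, hk⟩ := exists_eq_C_of_regular _ hreg
  rw [div_eq_iff P.twist_ne_zero] at hk
  refine ⟨k, fun α p hp => sub_eq_zero.mp (P.coeff_eq_zero_of_rational_eq_zero
    (c := fun α p => P.dual s α p - k * P.ℓ α p) ?_ α p hp)⟩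
  have : P.rational (fun α p => P.dual s α p - k * P.ℓ α p) =
      P.rational (P.dual s) - RatFunc.C k * P.twist := by
    simp only [twist_eq_rational, rational, Finset.mul_sum, ← Finset.sum_sub_distrib]
    refine Finset.sum_congr rfl fun α _ => Finset.sum_congr rfl fun p _ => ?_
    rw [map_sub, map_mul]
    ring
  rw [this, hk, sub_self]

end GaudinParameters

/-! ### The quadratic charges in terms of the currents -/

section Residue

theorem coeff_two_mul_mul (F G H : PowerSeries ℂ) : PowerSeries.coeff 2 (F * G * H) =
    PowerSeries.coeff 0 F * (PowerSeries.coeff 0 G * PowerSeries.coeff 2 H +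
      PowerSeries.coeff 1 G * PowerSeries.coeff 1 H +
      PowerSeries.coeff 2 G * PowerSeries.coeff 0 H) +
    PowerSeries.coeff 1 F * (PowerSeries.coeff 0 G * PowerSeries.coeff 1 H +
      PowerSeries.coeff 1 G * PowerSeries.coeff 0 H) +
    PowerSeries.coeff 2 F * (PowerSeries.coeff 0 G * PowerSeries.coeff 0 H) := by
  simp [PowerSeries.coeff_mul, Finset.Nat.antidiagonal_succ]
  ring

variable {S : Type*} [Fintype S] (P : GaudinParameters S)

/-- At a simple zero the residue is the product of the values of the two poles divided by 2φ'(ζ),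
with φ'(ζ) equal to minus ℓ of the squared kernel. -/
theorem GaudinParameters.residueAt_coe {ζ : ℂ} (h : ∀ α, P.z α ≠ ζ)
    (h0 : P.levelForm (P.kernel ζ) = 0) (h1 : P.levelForm (P.kernel ζ * P.kernel ζ) ≠ 0)
    (α β : S) (p q : ℕ) : residueAt ζ ((2 * P.twist)⁻¹ * (P.pole α p * P.pole β q)) =
      -((P.levelForm (P.kernel ζ * P.kernel ζ))⁻¹ / 2 *
        (PowerSeries.coeff p (P.kernel ζ α) * PowerSeries.coeff q (P.kernel ζ β))) := by
  set H := P.combine P.ℓ fun α p => P.poleSeries ζ α ^ (p + 1)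
  have hH0 : PowerSeries.coeff 0 H = 0 :=
    (P.coeff_combine_ℓ fun α p => P.coeff_zero_poleSeries ζ α p).trans h0
  have hH1 : PowerSeries.coeff 1 H = -P.levelForm (P.kernel ζ * P.kernel ζ) := by
    rw [← map_neg]
    refine P.coeff_combine_ℓ fun α p => ?_
    rw [P.coeff_one_poleSeries (h α) p, Pi.neg_apply, map_neg, Pi.mul_apply]
  obtain ⟨Q, hQ, hQ0⟩ := exists_inv_toLaurent 1 (fun j hj => by interval_cases j; exact hH0)
    (hH1.symm ▸ neg_ne_zero.mpr h1)
  have hE : expansionAt ζ P.twist = toLaurent H := by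
    rw [P.twist_eq_rational, P.expansionAt_rational_coe h, one_mul]
  have h2 : (2 : LaurentSeries ℂ)⁻¹ = toLaurent (PowerSeries.C (1 / 2)) := by
    refine inv_eq_of_mul_eq_one_right ?_
    rw [← map_ofNat toLaurent 2, ← map_mul, ← map_ofNat PowerSeries.C 2, ← map_mul]
    norm_num
  have hform : formAt ζ ((2 * P.twist)⁻¹ * (P.pole α p * P.pole β q)) =
      HahnSeries.single (-1) 1 * toLaurent (PowerSeries.C (1 / 2) * Q *
        (P.poleSeries ζ α ^ (p + 1) * P.poleSeries ζ β ^ (q + 1))) := by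
    rw [formAt, show jacobianAt (ζ : OnePoint ℂ) = 1 from rfl, map_mul, map_inv₀, map_mul,
      map_ofNat, hE, map_mul, P.expansionAt_coe_pole (h α), P.expansionAt_coe_pole (h β), mul_inv,
      hQ, h2]
    simp only [map_mul, Nat.cast_one]
    ring
  change (formAt ζ _).coeff (-1) = _
  rw [hform, coeff_single_mul_toLaurent _ _ 0 (by simp),
    PowerSeries.coeff_zero_eq_constantCoeff_apply, map_mul, map_mul, map_mul, hQ0, hH1,
    ← PowerSeries.coeff_zero_eq_constantCoeff_apply, ← PowerSeries.coeff_zero_eq_constantCoeff_apply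
    , ← PowerSeries.coeff_zero_eq_constantCoeff_apply,
    P.coeff_zero_poleSeries, P.coeff_zero_poleSeries, inv_neg,
    PowerSeries.coeff_zero_C]
  ring

/-- The residue is a second-order coefficient of a triple product. The contribution of first order
in both poles gives the square of the kernel; every other one has zeroth order in some pole, hence a
factor belonging to `1`, and goes into `w`. -/
theorem GaudinParameters.exists_residueAt_infty (hfirst : P.levelForm 1 = 0)
    (h0 : P.levelForm (P.kernel OnePoint.infty) = 0)
    (h1 : P.levelForm (P.kernel OnePoint.infty * P.kernel OnePoint.infty) ≠ 0) :
    ∃ w : S → PowerSeries ℂ, ∀ (α β : S) (p q : ℕ),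
      residueAt OnePoint.infty ((2 * P.twist)⁻¹ * (P.pole α p * P.pole β q)) =
      -((P.levelForm (P.kernel OnePoint.infty * P.kernel OnePoint.infty))⁻¹ / 2 *
        (PowerSeries.coeff p (P.kernel OnePoint.infty α) *
          PowerSeries.coeff q (P.kernel OnePoint.infty β)) +
        (PowerSeries.coeff p 1 * PowerSeries.coeff q (w β) +
          PowerSeries.coeff p (w α) * PowerSeries.coeff q 1)) := by
  set H := P.combine P.ℓ P.inftySeries
  have hH0 : PowerSeries.coeff 0 H = 0 :=
    (P.coeff_combine_ℓ (t := 1) P.coeff_zero_inftySeries).trans hfirst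
  have hH1 : PowerSeries.coeff 1 H = 0 := (P.coeff_combine_ℓ P.coeff_one_inftySeries).trans h0
  have hH2 : PowerSeries.coeff 2 H =
      P.levelForm (P.kernel OnePoint.infty * P.kernel OnePoint.infty) :=
    P.coeff_combine_ℓ P.coeff_two_inftySeries
  obtain ⟨Q, hQ, hQ0⟩ := exists_inv_toLaurent 2
    (fun j hj => by interval_cases j; exacts [hH0, hH1]) (hH2.symm ▸ h1)
  have h2 : (2 : LaurentSeries ℂ)⁻¹ = toLaurent (PowerSeries.C (1 / 2)) := by
    refine inv_eq_of_mul_eq_one_right ?_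
    rw [← map_ofNat toLaurent 2, ← map_mul, ← map_ofNat PowerSeries.C 2, ← map_mul]
    norm_num
  have hXY : (HahnSeries.single (1 : ℤ) (1 : ℂ)) * HahnSeries.single (-1) 1 = 1 := by
    rw [HahnSeries.single_mul_single]
    simp
  have hY2 : HahnSeries.single (-2 : ℤ) (1 : ℂ) =
      HahnSeries.single (-1) 1 * HahnSeries.single (-1) 1 := by
    rw [HahnSeries.single_mul_single]
    simp
  have hY3 : HahnSeries.single (-3 : ℤ) (1 : ℂ) =
      HahnSeries.single (-1) 1 * HahnSeries.single (-2) 1 := by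
    rw [HahnSeries.single_mul_single]
    simp
  have hE : expansionAt OnePoint.infty P.twist = HahnSeries.single 1 1 * toLaurent H := by
    rw [P.twist_eq_rational, P.expansionAt_rational_infty]
  have hpole : ∀ α p, expansionAt OnePoint.infty (P.pole α p) =
    HahnSeries.single 1 1 * toLaurent (P.inftySeries α p) := P.expansionAt_infty_pole
  have hform : ∀ α β p q, formAt OnePoint.infty ((2 * P.twist)⁻¹ * (P.pole α p * P.pole β q)) =
      -(HahnSeries.single (-3) 1 * toLaurent (PowerSeries.C (1 / 2) *
        (Q * P.inftySeries α p * P.inftySeries β q))) := by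
    intro α β p q
    rw [formAt, show jacobianAt OnePoint.infty = -(HahnSeries.single (-2 : ℤ) (1 : ℂ)) from rfl,
      map_mul, map_inv₀, map_mul, map_ofNat, hE, map_mul, hpole, hpole, mul_inv, mul_inv, hQ, h2,
      inv_eq_of_mul_eq_one_right hXY]
    simp only [map_mul, hY3, Nat.cast_ofNat, hY2]
    generalize (HahnSeries.single (1 : ℤ) (1 : ℂ)) = x at hXY ⊢
    generalize (HahnSeries.single (-1 : ℤ) (1 : ℂ)) = y at hXY ⊢
    linear_combination (-(toLaurent (PowerSeries.C (1 / 2)) * toLaurent Q *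
      toLaurent (P.inftySeries α p) * toLaurent (P.inftySeries β q) * y ^ 3 * (x * y + 1))) * hXY
  -- The term with zeroth order in both poles is shared between the two symmetric halves, hence its
  -- additional factor `1 / 2`.
  refine ⟨fun β => PowerSeries.mk fun q => (1 / 2) * (PowerSeries.coeff 0 Q *
    PowerSeries.coeff 2 (P.inftySeries β q) + PowerSeries.coeff 1 Q *
    PowerSeries.coeff 1 (P.inftySeries β q) + (1 / 2) * (PowerSeries.coeff 2 Q *
    PowerSeries.coeff 0 (P.inftySeries β q))), fun α β p q => ?_⟩
  change (formAt OnePoint.infty _).coeff (-1) = _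
  rw [hform, HahnSeries.coeff_neg, coeff_single_mul_toLaurent _ _ 2 (by simp),
    PowerSeries.coeff_C_mul, coeff_two_mul_mul, PowerSeries.coeff_mk, PowerSeries.coeff_mk,
    ← P.coeff_zero_inftySeries α p, ← P.coeff_zero_inftySeries β q, ← P.coeff_one_inftySeries α p,
    ← P.coeff_one_inftySeries β q, ← hH2, ← hQ0, PowerSeries.coeff_zero_eq_constantCoeff_apply Q]
  ring

theorem GaudinParameters.exists_residueAt [Nonempty S] (hfirst : ∑ α, P.ℓ α 0 = 0)
    {c : OnePoint ℂ} (hsimple : (formAt c P.twist).order ≤ 1)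
    (hc : 0 < (formAt c P.twist).order) :
    ∃ w : S → PowerSeries ℂ, ∀ (α β : S) (p q : ℕ),
      residueAt c ((2 * P.twist)⁻¹ * (P.pole α p * P.pole β q)) =
      -((P.levelForm (P.kernel c * P.kernel c))⁻¹ / 2 *
        (PowerSeries.coeff p (P.kernel c α) * PowerSeries.coeff q (P.kernel c β)) +
        (PowerSeries.coeff p 1 * PowerSeries.coeff q (w β) +
          PowerSeries.coeff p (w α) * PowerSeries.coeff q 1)) := by
  obtain ⟨h0, h1⟩ := P.levelForm_kernel hfirst hsimple hc
  cases c with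
  | infty => exact P.exists_residueAt_infty (P.levelForm_one hfirst) h0 h1
  | coe ζ =>
    refine ⟨0, fun α β p q => ?_⟩
    rw [P.residueAt_coe (P.ne_of_order_pos hc) h0 h1]
    simp

end Residue

namespace TakiffRealisation

variable {A 𝔤 S : Type*} [CommRing A] [Algebra ℂ A] [LieRing 𝔤] [LieAlgebra ℂ 𝔤] [Fintype S]
  {P : GaudinParameters S} {V : PoissonVertexAlgebra A} (R : TakiffRealisation P V 𝔤)
  {n : Type*} [Fintype n] [DecidableEq n] {e : Module.Basis n ℂ 𝔤} (he : IsOrthonormal e)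

theorem comp_includeRight (Y : 𝔤) (F : A ⊗[ℂ] 𝔤) :
    comp Y (LinearMap.rTensor 𝔤 (Algebra.TensorProduct.includeRight :
      A →ₐ[ℂ] RatFunc ℂ ⊗[ℂ] A).toLinearMap F) = (1 : RatFunc ℂ) ⊗ₜ[ℂ] comp Y F := by
  induction F using TensorProduct.induction_on with
  | zero => simp [comp]
  | add x y hx hy =>
    simp only [comp, map_add, TensorProduct.tmul_add] at *
    rw [hx, hy]
  | tmul a Z =>
    rw [LinearMap.rTensor_tmul, comp, comp, kappaA, kappaA, LinearMap.BilinForm.baseChange_tmul,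
      LinearMap.BilinForm.baseChange_tmul]
    simp

theorem comp_gaudinLax (Y : 𝔤) : comp Y R.gaudinLax =
    ∑ α, ∑ p ∈ Finset.range (P.m α), P.pole α p ⊗ₜ[ℂ] comp Y (R.J α p) := by
  rw [gaudinLax, comp]
  simp only [map_sum, map_smul]
  refine Finset.sum_congr rfl fun α _ => Finset.sum_congr rfl fun p _ => ?_
  rw [← comp, comp_includeRight, smul_eq_mul, Algebra.TensorProduct.tmul_mul_tmul, mul_one, one_mul]

theorem residueAtA_mul_sum (c : OnePoint ℂ) (f : RatFunc ℂ) {κ : Type*} (t : Finset κ)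
    (x : κ → RatFunc ℂ) (y : κ → A) :
    residueAtA A c ((f ⊗ₜ[ℂ] (1 : A)) * ((∑ i ∈ t, x i ⊗ₜ[ℂ] y i) * ∑ j ∈ t, x j ⊗ₜ[ℂ] y j)) =
      ∑ i ∈ t, ∑ j ∈ t, residueAt c (f * (x i * x j)) • (y i * y j) := by
  rw [Finset.sum_mul_sum, Finset.mul_sum, map_sum]
  refine Finset.sum_congr rfl fun i _ => ?_
  rw [Finset.mul_sum, map_sum]
  refine Finset.sum_congr rfl fun j _ => ?_
  rw [Algebra.TensorProduct.tmul_mul_tmul, Algebra.TensorProduct.tmul_mul_tmul, one_mul]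
  simp [residueAtA]

include he in
theorem q_eq_sum (c : OnePoint ℂ) : R.q c = -∑ a, ∑ α, ∑ p ∈ Finset.range (P.m α),
    ∑ β, ∑ q ∈ Finset.range (P.m β),
      residueAt c ((2 * P.twist)⁻¹ * (P.pole α p * P.pole β q)) •
        (comp (e a) (R.J α p) * comp (e a) (R.J β q)) := by
  rw [q, he.kappaA_eq_sum, Finset.mul_sum, map_sum]
  congr 1
  refine Finset.sum_congr rfl fun a _ => ?_
  rw [comp_gaudinLax, Finset.sum_sigma' Finset.univ fun α => Finset.range (P.m α),
    residueAtA_mul_sum, Finset.sum_sigma]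
  refine Finset.sum_congr rfl fun α _ => Finset.sum_congr rfl fun p _ => ?_
  rw [Finset.sum_sigma]

theorem current_mul_current (a : n) (s t : S → PowerSeries ℂ) :
    (R.currentAlgebra he).J a s * (R.currentAlgebra he).J a t =
      ∑ α, ∑ p ∈ Finset.range (P.m α), ∑ β, ∑ q ∈ Finset.range (P.m β),
        (PowerSeries.coeff p (s α) * PowerSeries.coeff q (t β)) •
          (comp (e a) (R.J α p) * comp (e a) (R.J β q)) := by
  change R.current (e a) s * R.current (e a) t = _
  rw [current_apply, current_apply]
  rw [Finset.sum_mul]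
  refine Finset.sum_congr rfl fun α _ => ?_
  rw [Finset.sum_mul]
  refine Finset.sum_congr rfl fun p _ => ?_
  simp only [Finset.mul_sum, smul_mul_smul_comm]

theorem exists_q_eq_charge [Nonempty S] (hfirst : ∑ α, P.ℓ α 0 = 0)
    {c : OnePoint ℂ} (hsimple : (formAt c P.twist).order ≤ 1)
    (hc : 0 < (formAt c P.twist).order) : ∃ v, R.q c = (R.currentAlgebra he).charge (P.kernel c) v
      (P.levelForm (P.kernel c * P.kernel c))⁻¹ := by
  obtain ⟨w, hw⟩ := P.exists_residueAt hfirst hsimple hc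
  -- The residue contains both `1 ⊗ w` and `w ⊗ 1`, which coincide in the commutative algebra `A`.
  refine ⟨(2 : ℂ) • w, ?_⟩
  rw [R.q_eq_sum he, CurrentAlgebra.charge, CurrentAlgebra.form, CurrentAlgebra.form,
    Finset.smul_sum, ← Finset.sum_add_distrib, ← Finset.sum_neg_distrib]
  refine Finset.sum_congr rfl fun a _ => ?_
  have : (R.currentAlgebra he).J a 1 * (R.currentAlgebra he).J a ((2 : ℂ) • w) =
      (R.currentAlgebra he).J a 1 * (R.currentAlgebra he).J a w +
        (R.currentAlgebra he).J a w * (R.currentAlgebra he).J a 1 := by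
    rw [map_smul, two_smul, mul_add, mul_comm ((R.currentAlgebra he).J a w)]
  rw [this]
  simp only [current_mul_current, hw, Finset.smul_sum, ← Finset.sum_add_distrib,
    ← Finset.sum_neg_distrib, smul_smul, ← add_smul, ← neg_smul, neg_neg]
  rfl

theorem momentumDensity_sub_mem [Nonempty S] (hfirst : ∑ α, P.ℓ α 0 = 0)
    (hsimple : ∀ c, (formAt c P.twist).order ≤ 1) {M : ℕ} {ζ : Fin M → OnePoint ℂ}
    (hzero : ∀ c, (∃ i, ζ i = c) ↔ 0 < (formAt c P.twist).order) {b : Fin M → ℂ}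
    (hu : (R.currentAlgebra he).IsOrthogonalFamily (fun i => P.kernel (ζ i)) b)
    (v : Fin M → S → PowerSeries ℂ) :
    R.momentumDensity - ∑ i, (R.currentAlgebra he).charge (P.kernel (ζ i)) (v i) (b i) ∈
      (R.currentAlgebra he).weakIdeal := by
  classical
  obtain ⟨w, hw⟩ := P.exists_levelForm_eq_one
  have hspan : ∀ s, P.levelForm s = 0 → (∀ i, P.levelForm (s * P.kernel (ζ i)) = 0) →
      ∃ k : ℂ, ∀ a, R.current (e a) s = k • R.current (e a) 1 := by
    intro s hs1 hs
    obtain ⟨k, hk⟩ := P.exists_dual_eq hfirst hsimple s hs1 fun c hc => by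
      obtain ⟨i, rfl⟩ := (hzero c).mpr hc
      exact hs i
    refine ⟨k, fun a => ?_⟩
    -- The coefficients below the multiplicity are pairings with dual elements, so they are
    -- determined by `dual s`, which `exists_dual_eq` shows to be proportional to the levels.
    have hco : ∀ α, ∀ p < P.m α, PowerSeries.coeff p (s α) =
        k * PowerSeries.coeff p ((1 : S → PowerSeries ℂ) α) := by
      intro α p hp
      rw [← P.levelForm_mul_dualElement s α p hp, ← P.levelForm_mul_dualElement 1 α p hp,
        P.levelForm_mul, P.levelForm_mul, Finset.mul_sum]
      refine Finset.sum_congr rfl fun β _ => ?_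
      rw [Finset.mul_sum]
      refine Finset.sum_congr rfl fun r hr => ?_
      rw [Finset.mem_range] at hr
      rw [hk β r hr, P.dual_one β r hr, mul_assoc]
    rw [current_apply, current_apply, Finset.smul_sum]
    refine Finset.sum_congr rfl fun α _ => ?_
    rw [Finset.smul_sum]
    refine Finset.sum_congr rfl fun p hp => ?_
    rw [hco α p (Finset.mem_range.mp hp), mul_smul]
  have hbasis : ∀ a α p, p < P.m α →
      R.current (e a) (Pi.single α (PowerSeries.X ^ p)) = comp (e a) (R.J α p) := by
    intro a α p hp
    rw [current_apply, Finset.sum_eq_single α, Finset.sum_eq_single p]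
    · simp
    · intro q _ hq
      simp [PowerSeries.coeff_X_pow, hq]
    · intro h
      exact absurd (Finset.mem_range.mpr hp) h
    · intro β _ hβ
      simp [hβ]
    · simp
  -- The dual families are the monomials at the sites and the elements built from the numbers `k`;
  -- their contraction is the Segal-Sugawara expression.
  have hmain := hu.sum_form_sub_mem v hspan hw
    (fun j : Σ α, Fin (P.m α) => Pi.single j.1 (PowerSeries.X ^ (j.2 : ℕ)))
    (fun j => P.dualElement j.1 j.2) (fun a t => by
      change R.current (e a) t = ∑ j : Σ α, Fin (P.m α), P.levelForm _ •
        R.current (e a) (Pi.single j.1 (PowerSeries.X ^ (j.2 : ℕ)))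
      rw [Fintype.sum_sigma, current_apply]
      refine Finset.sum_congr rfl fun α _ => ?_
      rw [Finset.sum_range]
      refine Finset.sum_congr rfl fun p _ => ?_
      rw [P.levelForm_mul_dualElement t α p p.2, hbasis a α p p.2])
  convert hmain using 2
  rw [Fintype.sum_sigma, Finset.smul_sum, momentumDensity]
  refine Finset.sum_congr rfl fun α _ => ?_
  rw [segalSugawara, Finset.sum_range]
  congr 1
  refine Finset.sum_congr rfl fun p _ => ?_
  change _ = ∑ a, R.current (e a) (Pi.single α (PowerSeries.X ^ (p : ℕ))) *
    R.current (e a) (P.dualElement α p)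
  simp only [he.kappaA_eq_sum, hbasis _ α p p.2, zero_le, if_true, Finset.smul_sum, Nat.sub_zero]
  rw [Finset.sum_comm]
  refine Finset.sum_congr rfl fun a _ => ?_
  rw [current_apply, Finset.sum_eq_single α]
  · rw [Finset.mul_sum]
    refine Finset.sum_congr rfl fun q _ => ?_
    rw [GaudinParameters.dualElement, Pi.single_eq_same, PowerSeries.coeff_mk, mul_smul_comm]
  · intro β _ hβ
    simp [GaudinParameters.dualElement, hβ]
  · simp

end TakiffRealisation

namespace TakiffRealisation

/-! ### The energy-momentum tensor -/

variable {A 𝔤 S : Type*} [CommRing A] [Algebra ℂ A] [LieRing 𝔤] [LieAlgebra ℂ 𝔤] [Fintype S]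
  {P : GaudinParameters S} {V : PoissonVertexAlgebra A} (R : TakiffRealisation P V 𝔤)
  {n : Type*} [Fintype n] [DecidableEq n] {e : Module.Basis n ℂ 𝔤} {he : IsOrthonormal e}
  {ι : Type*} [Fintype ι] (I : Module.Basis ι ℂ 𝔤)

theorem smul_mem_weakIdeal (c : ℂ) {f : A} (hf : f ∈ R.weakIdeal) : c • f ∈ R.weakIdeal := by
  rw [Algebra.smul_def]
  exact R.weakIdeal.mul_mem_left _ hf

/-- For a field whose bracket with the constraint vanishes weakly, the multiplier does not
contribute weakly to the time derivative. -/
theorem timeDeriv_add_mem_iff {O : A} (hO : ∀ Y : 𝔤, V.bracket (comp Y R.constraint) O ∈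
    R.weakIdeal.map (Polynomial.C : A →+* Polynomial A)) (h g : A) :
    R.timeDeriv I h O + MvPolynomial.C g ∈ R.weakIdeal.map (MvPolynomial.C (σ := ι × ℕ)) ↔
      (V.bracket h O).coeff 0 + g ∈ R.weakIdeal := by
  have hmu : ∑ a, ((V.bracket (comp (I a) R.constraint) O).sum fun k c =>
      MvPolynomial.X (a, k) * MvPolynomial.C c) ∈
        R.weakIdeal.map (MvPolynomial.C (σ := ι × ℕ)) := by
    refine sum_mem fun a _ => sum_mem fun k _ => Ideal.mul_mem_left _ _ ?_
    exact Ideal.mem_map_of_mem _ (Ideal.mem_map_C_iff.mp (hO (I a)) k)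
  rw [timeDeriv, add_right_comm, Ideal.add_mem_iff_left _ hmu, ← map_add]
  refine ⟨fun hmem => ?_, fun hmem => Ideal.mem_map_of_mem _ hmem⟩
  rw [MvPolynomial.mem_map_C_iff] at hmem
  -- The multiplier variables are independent, so the condition can be read off at the trivial
  -- monomial.
  simpa using hmem 0

variable {M : ℕ} {ζ : Fin M → OnePoint ℂ} {u : Fin M → S → PowerSeries ℂ} {b : Fin M → ℂ}
  {v : Fin M → S → PowerSeries ℂ}

/-- The charges at the zeros of the twist function come from an orthogonal family. -/
structure IsDiagonalisation (he : IsOrthonormal e) (ζ : Fin M → OnePoint ℂ)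
    (u v : Fin M → S → PowerSeries ℂ) (b : Fin M → ℂ) : Prop where
  orthogonal : (R.currentAlgebra he).IsOrthogonalFamily u b
  q_eq : ∀ i, R.q (ζ i) = (R.currentAlgebra he).charge (u i) (v i) (b i)
  momentum : R.momentumDensity - ∑ i, R.q (ζ i) ∈ R.weakIdeal

theorem exists_isDiagonalisation (he : IsOrthonormal e) (hfirst : ∑ α, P.ℓ α 0 = 0)
    (hsimple : ∀ c, (formAt c P.twist).order ≤ 1) (hinj : Function.Injective ζ)
    (hzero : ∀ c, (∃ i, ζ i = c) ↔ 0 < (formAt c P.twist).order) :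
    ∃ u v b, R.IsDiagonalisation he ζ u v b := by
  cases isEmpty_or_nonempty S with
  | inl hS =>
    -- Without sites the twist function is zero; the zero series has order `0` by convention, so
    -- there are no points ζ_i and the momentum density is an empty sum.
    have hM : IsEmpty (Fin M) := ⟨fun i => by
      have := (hzero (ζ i)).mp ⟨i, rfl⟩
      simp [GaudinParameters.twist, formAt] at this⟩
    refine ⟨0, 0, 0, ⟨P.levelForm_one hfirst, hM.elim, hM.elim, hM.elim, hM.elim⟩, hM.elim, ?_⟩
    simp [momentumDensity]
  | inr hS =>
    have hpos : ∀ i, 0 < (formAt (ζ i) P.twist).order := fun i => (hzero _).mp ⟨i, rfl⟩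
    have hl := fun i => P.levelForm_kernel hfirst (hsimple (ζ i)) (hpos i)
    choose v hv using fun i => R.exists_q_eq_charge he hfirst (hsimple (ζ i)) (hpos i)
    have hmul : ∀ i j, i ≠ j → ∃ x y z : ℂ, P.kernel (ζ i) * P.kernel (ζ j) =
        x • 1 + y • P.kernel (ζ i) + z • P.kernel (ζ j) := fun i j hij =>
      P.kernel_mul_kernel (hinj.ne hij) (hpos i) (hpos j)
    have hu : (R.currentAlgebra he).IsOrthogonalFamily (fun i => P.kernel (ζ i))
        (fun i => (P.levelForm (P.kernel (ζ i) * P.kernel (ζ i)))⁻¹) :=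
      { ℓ_one := P.levelForm_one hfirst
        ℓ_eq_zero := fun i => (hl i).1
        norm := fun i => inv_mul_cancel₀ (hl i).2
        -- The product of two kernels is a combination of `1` and the kernels themselves, on all of
        -- which the level form vanishes.
        orthogonal := fun i j hij => by
          obtain ⟨x, y, z, h⟩ := hmul i j hij
          change P.levelForm _ = 0
          rw [h, map_add, map_add, map_smul, map_smul, map_smul, P.levelForm_one hfirst, (hl i).1,
            (hl j).1]
          simp
        mul_mem := hmul }
    refine ⟨_, v, _, hu, hv, ?_⟩
    rw [← R.weakIdeal_currentAlgebra he, Finset.sum_congr rfl fun i _ => hv i]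
    exact R.momentumDensity_sub_mem he hfirst hsimple hzero hu v

theorem bracket_constraint_mem_of_forall (he : IsOrthonormal e) {f : A}
    (hf : ∀ a, V.bracket ((R.currentAlgebra he).J a 1) f ∈
      R.weakIdeal.map (Polynomial.C : A →+* Polynomial A)) (Y : 𝔤) :
    V.bracket (comp Y R.constraint) f ∈
      R.weakIdeal.map (Polynomial.C : A →+* Polynomial A) := by
  rw [he.comp_eq_sum, map_sum, LinearMap.sum_apply]
  refine sum_mem fun a _ => ?_
  rw [map_smul, LinearMap.smul_apply, Algebra.smul_def, ← current_one]
  exact Ideal.mul_mem_left _ _ (hf a)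

namespace IsDiagonalisation

variable {R} (H : R.IsDiagonalisation he ζ u v b)
include H

theorem bracket_constraint_mem (Y : 𝔤) {f : A} (c : Fin M → ℂ)
    (hf : f - ∑ i, c i • R.q (ζ i) ∈ R.weakIdeal) : V.bracket (comp Y R.constraint) f ∈
      R.weakIdeal.map (Polynomial.C : A →+* Polynomial A) := by
  refine R.bracket_constraint_mem_of_forall he (fun a => ?_) Y
  rw [← sub_add_cancel f (∑ i, c i • R.q (ζ i)), map_add, map_sum]
  refine add_mem ?_ (sum_mem fun i _ => ?_)
  · rw [← R.weakIdeal_currentAlgebra he] at hf ⊢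
    exact (R.currentAlgebra he).bracket_J_one_mem H.orthogonal.ℓ_one a hf
  · rw [map_smul, Algebra.smul_def, H.q_eq, ← R.weakIdeal_currentAlgebra he]
    exact Ideal.mul_mem_left _ _ ((R.currentAlgebra he).bracket_J_one_charge H.orthogonal.ℓ_one
      (H.orthogonal.ℓ_eq_zero i) _ _ a)

theorem coeff_bracket_q (i j : Fin M) : (V.bracket (R.q (ζ i)) (R.q (ζ j))).coeff 0 -
    (if i = j then V.D (R.q (ζ j)) else 0) ∈ R.weakIdeal := by
  rw [H.q_eq, H.q_eq, ← R.weakIdeal_currentAlgebra he]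
  exact H.orthogonal.coeff_zero_bracket_charge v i j

theorem coeff_bracket_q_mem (i : Fin M) {f : A} (hf : f ∈ R.weakIdeal) :
    (V.bracket (R.q (ζ i)) f).coeff 0 ∈ R.weakIdeal := by
  rw [← R.weakIdeal_currentAlgebra he] at hf ⊢
  rw [H.q_eq]
  exact Ideal.mem_map_C_iff.mp ((R.currentAlgebra he).bracket_mem_of_firstClass
    ((R.currentAlgebra he).bracket_J_one_charge H.orthogonal.ℓ_one (H.orthogonal.ℓ_eq_zero i)
      (v i) (b i)) hf) 0

theorem coeff_bracket_hamiltonian (ε c : Fin M → ℂ) {f : A}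
    (hf : f - ∑ i, c i • R.q (ζ i) ∈ R.weakIdeal) :
    (V.bracket (R.hamiltonianDensity ζ ε) f).coeff 0 - ∑ i, (ε i * c i) • V.D (R.q (ζ i)) ∈
      R.weakIdeal := by
  have h1 : ∀ i, (V.bracket (R.q (ζ i)) f).coeff 0 - c i • V.D (R.q (ζ i)) ∈ R.weakIdeal := by
    intro i
    have h2 := sum_mem (t := Finset.univ) fun j _ =>
      R.smul_mem_weakIdeal (c j) (H.coeff_bracket_q i j)
    have h3 := H.coeff_bracket_q_mem i hf
    have h4 := add_mem h3 h2
    simp only [smul_sub, Finset.sum_sub_distrib, map_sub, map_sum, map_smul, smul_ite, smul_zero,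
      Polynomial.coeff_sub, Polynomial.finsetSum_coeff, Polynomial.coeff_smul, Finset.sum_ite_eq,
      Finset.mem_univ, if_true, sub_add_sub_cancel] at h4
    exact h4
  have h5 := sum_mem (t := Finset.univ) fun i _ => R.smul_mem_weakIdeal (ε i) (h1 i)
  simp only [smul_sub, Finset.sum_sub_distrib, smul_smul] at h5
  simp only [hamiltonianDensity, map_sum, map_smul, LinearMap.sum_apply, LinearMap.smul_apply,
    Polynomial.finsetSum_coeff, Polynomial.coeff_smul]
  exact h5

/-- The Hamiltonian flow multiplies the coefficient of each charge by `ε i` and differentiates the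
charge, and the multiplier drops out. The energy equation is the case `c = ε`, the momentum equation
`c = 1`. -/
theorem conservation_iff (ε c : Fin M → ℂ) {f g : A}
    (hf : f - ∑ i, c i • R.q (ζ i) ∈ R.weakIdeal) :
    R.timeDeriv I (R.hamiltonianDensity ζ ε) f + MvPolynomial.C (V.D g) ∈
      R.weakIdeal.map (MvPolynomial.C (σ := ι × ℕ)) ↔
      V.D (g + ∑ i, (ε i * c i) • R.q (ζ i)) ∈ R.weakIdeal := by
  rw [R.timeDeriv_add_mem_iff I fun Y => H.bracket_constraint_mem Y c hf]
  have h := H.coeff_bracket_hamiltonian ε c hf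
  have hsum : (V.bracket (R.hamiltonianDensity ζ ε) f).coeff 0 + V.D g =
      ((V.bracket (R.hamiltonianDensity ζ ε) f).coeff 0 - ∑ i, (ε i * c i) • V.D (R.q (ζ i))) +
        V.D (g + ∑ i, (ε i * c i) • R.q (ζ i)) := by
    simp only [map_add, map_sum, Derivation.map_smul]
    ring
  rw [hsum, Ideal.add_mem_iff_right _ h]

theorem isEnergyMomentumTensor_iff (ε : Fin M → ℂ) (T : Fin 2 → Fin 2 → A) :
    R.IsEnergyMomentumTensor I ζ ε T ↔
      R.WeakEq (T 0 1) (∑ i, R.q (ζ i)) ∧ R.WeakEq (T 0 0) (∑ i, ε i • R.q (ζ i)) ∧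
      V.D (T 1 1 + ∑ i, ε i • R.q (ζ i)) ∈ R.weakIdeal ∧
      V.D (T 1 0 + ∑ i, ε i ^ 2 • R.q (ζ i)) ∈ R.weakIdeal := by
  have hmom : R.WeakEq (T 0 1) R.momentumDensity ↔ R.WeakEq (T 0 1) (∑ i, R.q (ζ i)) := by
    rw [WeakEq, WeakEq, ← sub_add_sub_cancel (T 0 1) R.momentumDensity (∑ i, R.q (ζ i)),
      Ideal.add_mem_iff_left _ H.momentum]
  have h0 : R.WeakEq (T 0 0) (∑ i, ε i • R.q (ζ i)) → _ := H.conservation_iff I ε ε (g := T 1 0)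
  have h1 : R.WeakEq (T 0 1) (∑ i, R.q (ζ i)) → _ := fun h =>
    H.conservation_iff I ε 1 (f := T 0 1) (g := T 1 1) (by simpa [WeakEq] using h)
  simp only [Pi.one_apply, mul_one] at h1
  simp only [← pow_two] at h0
  constructor
  · intro hT
    have hm := hmom.mp hT.momentum
    exact ⟨hm, hT.energy, (h1 hm).mp (hT.conservation 1), (h0 hT.energy).mp (hT.conservation 0)⟩
  · rintro ⟨hm, he, hc1, hc0⟩
    refine ⟨he, hmom.mpr hm, fun ν => ?_⟩
    fin_cases ν
    · exact (h0 he).mpr hc0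
    · exact (h1 hm).mpr hc1

theorem isRelativistic_iff [Nonempty n] (hW : (1 : A) ∉ R.weakIdeal) (ε : Fin M → ℂ) :
    R.IsRelativistic I ζ ε ↔ ∀ i, ε i = 1 ∨ ε i = -1 := by
  have hlow : ∀ T : Fin 2 → Fin 2 → A, lowered T 0 1 = T 0 1 ∧ lowered T 1 0 = -T 1 0 := by
    intro T
    simp [lowered, minkowski, Fin.sum_univ_two]
  constructor
  · rintro ⟨T, hT, hsym⟩ i
    obtain ⟨hm, -, -, hc0⟩ := (H.isEnergyMomentumTensor_iff I ε T).mp hT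
    have hs := hsym 0 1
    rw [(hlow T).1, (hlow T).2, WeakEq, sub_neg_eq_add] at hs
    have hD : ∀ f ∈ R.weakIdeal, V.D f ∈ R.weakIdeal := fun f hf => by
      rw [← R.weakIdeal_currentAlgebra he] at hf ⊢
      exact (R.currentAlgebra he).D_mem_weakIdeal hf
    -- Symmetry is differentiated, because `T 1 0` is known only up to a spatially constant field;
    -- this is why independence is needed for the derivatives of the charges.
    have hdiff : ∑ i, (ε i ^ 2 - 1) • V.D (R.q (ζ i)) ∈ R.weakIdeal := by
      have h := add_mem (sub_mem hc0 (hD _ hs)) (hD _ hm)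
      convert h using 1
      simp only [sub_smul, one_smul, Finset.sum_sub_distrib, map_add, map_sub, map_sum,
        Derivation.map_smul]
      ring
    rw [← R.weakIdeal_currentAlgebra he] at hW hdiff
    simp only [H.q_eq] at hdiff
    have h0 := H.orthogonal.eq_zero_of_sum_mem v hW (fun i => ε i ^ 2 - 1) hdiff i
    have hfac : (ε i - 1) * (ε i + 1) = 0 := by linear_combination h0
    exact (mul_eq_zero.mp hfac).imp sub_eq_zero.mp eq_neg_of_add_eq_zero_left
  · intro hε
    have hsq : ∀ i, ε i ^ 2 = 1 := fun i => by rcases hε i with h | h <;> simp [h]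
    refine ⟨![![∑ i, ε i • R.q (ζ i), ∑ i, R.q (ζ i)],
      ![-∑ i, ε i ^ 2 • R.q (ζ i), -∑ i, ε i • R.q (ζ i)]],
      (H.isEnergyMomentumTensor_iff I ε _).mpr (by simp [WeakEq]), fun μ ν => ?_⟩
    fin_cases μ <;> fin_cases ν <;> simp [WeakEq, lowered, minkowski, Fin.sum_univ_two, hsq]

end IsDiagonalisation

end TakiffRealisation

end AffineGaudin

end

open AffineGaudin
theorem mainTheorem7
    {𝔤 : Type*} [LieRing 𝔤] [LieAlgebra ℂ 𝔤] [FiniteDimensional ℂ 𝔤] [LieAlgebra.IsSemisimple ℂ 𝔤]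
    {ι : Type*} [Fintype ι] (I : Module.Basis ι ℂ 𝔤)
    {A : Type*} [CommRing A] [Algebra ℂ A] (V : PoissonVertexAlgebra A)
    {S : Type*} [Fintype S] (P : GaudinParameters S)
    (R : TakiffRealisation P V 𝔤) (hsuit : R.IsSuitable)
    -- the constraint is first-class
    (hfirst : ∑ α, P.ℓ α 0 = 0)
    -- the zeroes of `φ(z) dz` on the Riemann sphere are simple, and are `ζ_1, ..., ζ_M`
    (hsimple : ∀ c, (formAt c P.twist).order ≤ 1)
    {M : ℕ} (ζ : Fin M → OnePoint ℂ) (hinj : Function.Injective ζ)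
    (hzero : ∀ c, (∃ i, ζ i = c) ↔ 0 < (formAt c P.twist).order)
    (ε : Fin M → ℂ) :
    -- the announced expressions form an energy-momentum tensor
    R.IsEnergyMomentumTensor I ζ ε
        ![![∑ i, ε i • R.q (ζ i), ∑ i, R.q (ζ i)],
          ![-∑ i, ε i ^ 2 • R.q (ζ i), -∑ i, ε i • R.q (ζ i)]] ∧
    -- any energy-momentum tensor is of this form (`T^1_ν` up to a spatially constant field)
    (∀ T, R.IsEnergyMomentumTensor I ζ ε T →
      R.WeakEq (T 0 1) (∑ i, R.q (ζ i)) ∧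
      R.WeakEq (T 0 0) (∑ i, ε i • R.q (ζ i)) ∧
      (∃ c, R.WeakEq (V.D c) 0 ∧ R.WeakEq (T 1 1) (-∑ i, ε i • R.q (ζ i) + c)) ∧
      (∃ c, R.WeakEq (V.D c) 0 ∧ R.WeakEq (T 1 0) (-∑ i, ε i ^ 2 • R.q (ζ i) + c))) ∧
    -- the model is relativistic exactly when all `ε_i` are `1` or `-1`
    (Nontrivial 𝔤 → (1 : A) ∉ R.weakIdeal →
      (R.IsRelativistic I ζ ε ↔ ∀ i, ε i = 1 ∨ ε i = -1)) := by
  obtain ⟨e, he⟩ := exists_isOrthonormal (𝔤 := 𝔤)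
  obtain ⟨u, v, b, H⟩ := R.exists_isDiagonalisation he hfirst hsimple hinj hzero
  refine ⟨(H.isEnergyMomentumTensor_iff I ε _).mpr (by simp [TakiffRealisation.WeakEq]),
    fun T hT => ?_, fun _ hW => ?_⟩
  · obtain ⟨hm, h00, hc1, hc0⟩ := (H.isEnergyMomentumTensor_iff I ε T).mp hT
    exact ⟨hm, h00,
      -- The spatially constant field is the deviation from the announced expression.
      ⟨T 1 1 + ∑ i, ε i • R.q (ζ i), by rwa [TakiffRealisation.WeakEq, sub_zero],
        by simp [TakiffRealisation.WeakEq]⟩,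
      ⟨T 1 0 + ∑ i, ε i ^ 2 • R.q (ζ i), by rwa [TakiffRealisation.WeakEq, sub_zero],
        by simp [TakiffRealisation.WeakEq]⟩⟩
  · have : Nonempty (Fin (Module.finrank ℂ 𝔤)) := ⟨⟨0, Module.finrank_pos⟩⟩
    exact H.isRelativistic_iff I hW ε
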